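/- Model. A labeled graph is a pair $(G,\ell)$ with $G=(V,E)$ a finite non-empty simple graph and $\ell:V\to\{0,1\}^*$; a distributed language is a set of labeled graphs. In an $m$-node network every node knows $m$, its own identifier, its label, and the identifiers of its neighbors; identifiers are distinct, chosen adversarially in $[1,N(m)]$, where $m\le N(m)\le \mathrm{poly}(m)$. All nodes run the same synchronous algorithm, with unrestricted local computation. In a LOCAL round, every node sends to each of its neighbors a message of arbitrary size; in a CONGEST round, it sends to each of its neighbors a (possibly different) message of $O(\log m)$ bits; in a BCC round, it sends one same message of $O(\log m)$ bits to all nodes of the network. Eventually each node accepts or rejects. A deterministic algorithm decides a language $\mathcal L$ if, for every labeled graph and every choice of identifiers, $(G,\ell)\in\mathcal L$ if and only if all nodes accept. A randomized algorithm (nodes may share their random coins; private coins are a special case) decides $\mathcal L$ with error probability $p$ if on every $(G,\ell)\in\mathcal L$ all nodes accept with probability at least $1-p$, and on every $(G,\ell)\notin\mathcal L$ at least one node rejects with probability at least $1-p$. Let $\mathbf{CC}$ be the class of languages decided by a deterministic algorithm performing two CONGEST rounds, and $\mathbf{LB}^*$ the class of languages decided by a deterministic algorithm performing one LOCAL round followed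 by $k$ BCC rounds, for some constant $k\ge 0$. Language. For $n\ge 1$ let $G_n$ be the graph whose node set is the disjoint union of $V_1,V_2,V_3,V_4$, with $V_a=\{v_{a,1},\dots,v_{a,n}\}$, and whose edges are all pairs between $V_1$ and $V_2$, between $V_2$ and $V_3$, and between $V_3$ and $V_4$. For Boolean $n\times n$ matrices $X,Y$ let $\ell_{X,Y}$ be the labeling in which every node has the number $a$ of its part $V_a$, the node $v_{1,i}$ has moreover its index $i$ and the $i$-th row of $X$, and the node $v_{4,i}$ has moreover its index $i$ and the $i$-th row of $Y$ (the number $a$ is encoded on two bits, and $i$ by its $n$-bit indicator vector). Let $\mathcal{D}$ be the set of all labeled graphs isomorphic to $(G_n,\ell_{X,Y})$ for some $n\ge 1$ and some $X,Y\in\{0,1\}^{n\times n}$ such that there are no $i,j$ with $X_{ij}=Y_{ij}=1$. Theorem. $\mathcal{D}\in\mathbf{CC}\smallsetminus\mathbf{LB}^*$, hence $\mathbf{CC}\smallsetminus\mathbf{LB}^*\neq\varnothing$. This holds even against randomized algorithms: for every $\varepsilon>0$ and every constant $k\ge 0$, no randomized algorithm performing one LOCAL round followed by $k$ BCC rounds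 decides $\mathcal{D}$ with error probability $\frac12-\varepsilon$. -/

import Mathlib

open MeasureTheory

namespace HybridModels

/-- A labeled graph `(G, ℓ)` with at least one node and `ℓ : V → {0,1}*`; the node set is `Fin size`.
The numbering of the nodes is never visible to a distributed algorithm. -/
structure LabeledGraph where
  size : ℕ
  size_pos : 0 < size
  graph : SimpleGraph (Fin size)
  label : Fin size → List Bool

/-- A distributed language is a collection of labeled graphs. -/
abbrev DistributedLanguage := Set LabeledGraph

/-- The three kinds of communication rounds. -/
inductive RoundKind
  | localRound
  | congestRound
  | bccRound

/-- Identifiers of `n`-node networks are taken in `[1, N n]`; the range must allow one-to-one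
identifiers and be polynomial in `n`. -/
def IsIdRange (N : ℕ → ℕ) : Prop :=
  (∀ n, n ≤ N n) ∧ ∃ d : ℕ, ∀ n, N n ≤ n ^ d + d

/-- `ident` is a legal assignment of identifiers to the nodes of an `n`-node network. -/
def IsIdAssignment (N : ℕ → ℕ) {n : ℕ} (ident : Fin n → ℕ) : Prop :=
  Function.Injective ident ∧ ∀ v, 1 ≤ ident v ∧ ident v ≤ N n

/-- A synchronous distributed algorithm run by all the nodes, with random seed in `Ω`
(`Ω = Unit` for deterministic algorithms). The seed is visible to all nodes; a node may restrict
itself to the part of the seed that is indexed by its identifier, so that algorithms with private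
independent coins are a special case. There is no restriction on local computation, and `State n`
is the type of states of a node in an `n`-node network. -/
structure HybridAlgorithm (Ω : Type) where
  State : ℕ → Type
  /-- Initial state of a node, which knows the size `n` of the network, the seed, its own
  identifier, the set of identifiers of its neighbors, and its own label. -/
  init : (n : ℕ) → Ω → ℕ → Finset ℕ → List Bool → State n
  /-- Message sent in a LOCAL round to the neighbor with the given identifier. -/
  localMsg : {n : ℕ} → State n → ℕ → List Bool
  /-- Message sent in a CONGEST round to the neighbor with the given identifier. -/
  congestMsg : {n : ℕ} → State n → ℕ → List Bool
  /-- Message broadcast to all the nodes in a BCC round. -/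
  bccMsg : {n : ℕ} → State n → List Bool
  /-- New state at the end of a round, as a function of the old one and of the set of received
  messages, each of them with the identifier of its sender. -/
  recv : {n : ℕ} → State n → Finset (ℕ × List Bool) → State n
  /-- Final decision of the node: accept (`true`) or reject (`false`). -/
  accept : {n : ℕ} → State n → Bool

namespace HybridAlgorithm

variable {Ω : Type}

/-- In CONGEST and BCC rounds, messages have `O(log n)` bits in `n`-node networks. (The `+ 1`
only matters for `n = 1`.) -/
def BoundedBandwidth (A : HybridAlgorithm Ω) : Prop :=
  ∃ c : ℕ, ∀ (n : ℕ) (s : A.State n),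
    (∀ dest : ℕ, (A.congestMsg s dest).length ≤ c * (Nat.log 2 n + 1)) ∧
      (A.bccMsg s).length ≤ c * (Nat.log 2 n + 1)

open Classical in
/-- The states of all nodes before the first round. -/
noncomputable def initial (A : HybridAlgorithm Ω) (I : LabeledGraph) (ident : Fin I.size → ℕ)
    (ω : Ω) : Fin I.size → A.State I.size :=
  fun v => A.init I.size ω (ident v)
    ((Finset.univ.filter fun u => I.graph.Adj v u).image ident) (I.label v)

open Classical in
/-- The set of messages received by `v` in a round of the given kind, if the states of the nodes
before that round are given by `s`. -/
noncomputable def inbox (A : HybridAlgorithm Ω) (I : LabeledGraph) (ident : Fin I.size → ℕ)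
    (s : Fin I.size → A.State I.size) (v : Fin I.size) : RoundKind → Finset (ℕ × List Bool)
  | .localRound =>
      (Finset.univ.filter fun u => I.graph.Adj v u).image
        fun u => (ident u, A.localMsg (s u) (ident v))
  | .congestRound =>
      (Finset.univ.filter fun u => I.graph.Adj v u).image
        fun u => (ident u, A.congestMsg (s u) (ident v))
  | .bccRound => Finset.univ.image fun u => (ident u, A.bccMsg (s u))

/-- The states of all nodes after performing the rounds of the given schedule in order. -/
noncomputable def run (A : HybridAlgorithm Ω) (I : LabeledGraph) (ident : Fin I.size → ℕ) :
    List RoundKind → (Fin I.size → A.State I.size) → (Fin I.size → A.State I.size)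
  | [], s => s
  | r :: rs, s => A.run I ident rs fun v => A.recv (s v) (A.inbox I ident s v r)

/-- After the rounds of the schedule `σ`, all nodes accept. -/
def AllAccept (A : HybridAlgorithm Ω) (σ : List RoundKind) (I : LabeledGraph)
    (ident : Fin I.size → ℕ) (ω : Ω) : Prop :=
  ∀ v, A.accept (A.run I ident σ (A.initial I ident ω) v) = true

/-- A deterministic algorithm with schedule `σ` decides `L`: for every labeled graph and every
legal assignment of identifiers, the labeled graph is in `L` iff all nodes accept. -/
def Decides (A : HybridAlgorithm Unit) (N : ℕ → ℕ) (σ : List RoundKind)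
    (L : DistributedLanguage) : Prop :=
  ∀ (I : LabeledGraph) (ident : Fin I.size → ℕ), IsIdAssignment N ident →
    (I ∈ L ↔ A.AllAccept σ I ident ())

/-- A randomized algorithm with schedule `σ` and seed distributed as `μ` decides `L` with error
probability at most `p`: on a yes-instance all nodes accept with probability at least `1 - p`, on
a no-instance some node rejects with probability at least `1 - p`. -/
def DecidesWithError [MeasurableSpace Ω] (A : HybridAlgorithm Ω) (μ : Measure Ω) (p : ℝ)
    (N : ℕ → ℕ) (σ : List RoundKind) (L : DistributedLanguage) : Prop :=
  ∀ (I : LabeledGraph) (ident : Fin I.size → ℕ), IsIdAssignment N ident →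
    MeasurableSet {ω | A.AllAccept σ I ident ω} ∧
    (I ∈ L → 1 - p ≤ μ.real {ω | A.AllAccept σ I ident ω}) ∧
    (I ∉ L → 1 - p ≤ μ.real {ω | ¬ A.AllAccept σ I ident ω})

end HybridAlgorithm

/-- The class of languages decidable by a deterministic algorithm with round schedule `σ`. -/
def hybridClass (N : ℕ → ℕ) (σ : List RoundKind) : Set DistributedLanguage :=
  {L | ∃ A : HybridAlgorithm Unit, A.BoundedBandwidth ∧ A.Decides N σ L}

/-- The class of languages decidable with error probability at most `p` by a randomized algorithm
with round schedule `σ`. -/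
def randHybridClass (N : ℕ → ℕ) (p : ℝ) (σ : List RoundKind) : Set DistributedLanguage :=
  {L | ∃ (Ω : Type) (_ : MeasurableSpace Ω) (μ : Measure Ω) (_ : IsProbabilityMeasure μ)
    (A : HybridAlgorithm Ω), A.BoundedBandwidth ∧ A.DecidesWithError μ p N σ L}

/-- The class `CC`: two CONGEST rounds. -/
def classCC (N : ℕ → ℕ) : Set DistributedLanguage :=
  hybridClass N [.congestRound, .congestRound]

/-- One LOCAL round followed by `k` BCC rounds. -/
def scheduleLB (k : ℕ) : List RoundKind :=
  .localRound :: List.replicate k .bccRound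

/-- The class `LB*`: one LOCAL round followed by a constant number of BCC rounds. -/
def classLBStar (N : ℕ → ℕ) : Set DistributedLanguage :=
  ⋃ k : ℕ, hybridClass N (scheduleLB k)

/-- The randomized version of `LB*` with error probability at most `p`. -/
def randClassLBStar (N : ℕ → ℕ) (p : ℝ) : Set DistributedLanguage :=
  ⋃ k : ℕ, randHybridClass N p (scheduleLB k)

/-- `DISJ(X, Y) = 1` for two `n × n` Boolean matrices. -/
def Disj {n : ℕ} (X Y : Fin n → Fin n → Bool) : Prop :=
  ¬ ∃ i j, X i j = true ∧ Y i j = true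

/-- The node `(a, i)` is the `i`-th node of the part `V_{a+1}`, and consecutive parts are completely
joined: `V₁ - V₂ - V₃ - V₄`. -/
def fourLayerGraph (n : ℕ) : SimpleGraph (Fin 4 × Fin n) where
  Adj u v := u.1.val + 1 = v.1.val ∨ v.1.val + 1 = u.1.val
  symm := ⟨fun _ _ h => h.symm⟩
  loopless := ⟨fun _ h => by omega⟩

/-- The part of a node in two bits. -/
def partBits : Fin 4 → List Bool
  | 0 => [false, false]
  | 1 => [false, true]
  | 2 => [true, false]
  | 3 => [true, true]

/-- The `n`-bit indicator vector of `i`. -/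
def indexBits {n : ℕ} (i : Fin n) : List Bool :=
  List.ofFn fun j : Fin n => decide (j = i)

/-- The input of a node: the `i`-th node of `V₁` (resp. `V₄`) has the `i`-th row of `X` (resp. `Y`)
together with its index `i`, and the nodes of `V₂` and `V₃` have no input. -/
def inputBits {n : ℕ} (X Y : Fin n → Fin n → Bool) : Fin 4 × Fin n → List Bool
  | (0, i) => indexBits i ++ List.ofFn (X i)
  | (1, _) => []
  | (2, _) => []
  | (3, i) => indexBits i ++ List.ofFn (Y i)

/-- The labeling `ℓ_{X,Y}` of `fourLayerGraph n`. -/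
def disjLabel {n : ℕ} (X Y : Fin n → Fin n → Bool) (v : Fin 4 × Fin n) : List Bool :=
  partBits v.1 ++ inputBits X Y v

/-- The disjointness language: all labeled graphs isomorphic to `fourLayerGraph n` with labeling
`ℓ_{X,Y}`, for some `n` and some `n × n` matrices with `DISJ(X, Y) = 1`. -/
def disjFourLayer : DistributedLanguage :=
  {I | ∃ (n : ℕ) (X Y : Fin n → Fin n → Bool) (e : I.graph ≃g fourLayerGraph n),
    Disj X Y ∧ ∀ v, I.label v = disjLabel X Y (e v)}

end HybridModels

/-! Lower bound. On a hard instance, after one LOCAL round the nodes of V₁ ∪ V₂ have seen no label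
that depends on Y, and those of V₃ ∪ V₄ none that depends on X (`localState_left`,
`localState_right`). The BCC rounds are then a two-party protocol with shared coins: for a fixed
seed, the broadcast bits and the two verdicts partition the pairs (X, Y) into rectangles
(`transcript_exchange`). With k rounds there are O(k n log n) broadcast bits, whereas disjointness
on n² coordinates needs a number of bits linear in n², even with error 1/2 - ε.

That bound is `disjointness_bound`. The coordinates are split at random between the players by a
mask D, which makes the inputs disjoint, and one coordinate j is set in both inputs to `false` or to
`true`. By cut-and-paste, the Hellinger distance between the transcripts in these two cases is
controlled by the effect of changing j for one player at a time. The level-one inequality bounds the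
total effect over all j of one rectangle of probability p by 4 · `negMulLog` p, and the sum over
rectangles is 4 times an entropy, hence at most 4 log of their number.

Upper bound. Nodes of one part are ranked by identifier. In the first round, the i-th node of V₄
sends Y_{ij} to the node of V₃ of rank j, which thus learns column j of Y. The i-th node of V₁ sends
X_{ic} with c = i + k mod n to the node of V₂ of rank k: the cyclic shift gives each node of V₂
exactly one entry of each column. In the second round it forwards the entry of column j, if it is 1,
to the node of V₃ of rank j, so no link carries more than one entry. First-round packets also reveal
part and index, and counting neighbors in each part certifies the graph
(`isLayered_of_locallyValid`). -/

namespace HybridModels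

/-! ### Communication lower bound for set disjointness, by Fourier analysis and Hellinger distances.
-/

section Disjointness

open Finset Real
open scoped BigOperators

variable {ι : Type*} [Fintype ι] [DecidableEq ι]

/-- The sign of a bit. -/
def bitSign (b : Bool) : ℝ := if b then 1 else -1

theorem expect_split (j : ι) (φ : (ι → Bool) → ℝ) :
    𝔼 z, φ z = ((𝔼 z, φ (Function.update z j false)) + 𝔼 z, φ (Function.update z j true)) / 2 := by
  have hinv : Function.Involutive (fun z : ι → Bool => Function.update z j (!z j)) := by
    intro z; simp
  have hflip : 𝔼 z, φ (Function.update z j (!z j)) = 𝔼 z, φ z :=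
    Fintype.expect_equiv hinv.toPerm _ _ (fun _ => rfl)
  have h : ∀ z : ι → Bool, φ (Function.update z j false) + φ (Function.update z j true) =
      φ z + φ (Function.update z j (!z j)) := by
    intro z
    have hz : Function.update z j (z j) = z := Function.update_eq_self j z
    cases hb : z j
    · rw [hb] at hz; simp [hz]
    · rw [hb] at hz; simp [hz, add_comm]
  rw [← expect_add_distrib, expect_congr rfl (fun z _ => h z), expect_add_distrib, hflip]
  ring

/-- The signs are independent, so the moment generating function factors, and each factor is a
`cosh`. -/
theorem expect_exp_sign (b : ι → ℝ) :
    𝔼 z : ι → Bool, exp (∑ j, b j * bitSign (z j)) = ∏ j, cosh (b j) := by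
  have h := Finset.prod_univ_sum (fun _ : ι => (univ : Finset Bool))
    (fun j c => exp (b j * bitSign c))
  rw [Fintype.piFinset_univ] at h
  rw [Fintype.expect_eq_sum_div_card]
  simp_rw [exp_sum]
  rw [← h]
  have h2 : ∀ j, ∑ c : Bool, exp (b j * bitSign c) = 2 * cosh (b j) := by
    intro j
    rw [cosh_eq]; simp [bitSign]; ring
  simp_rw [h2]
  rw [prod_mul_distrib]
  simp

/-- Level-one inequality: a function `u` on the cube with values in `[0, 1]` and mean `F` has
level-one Fourier weight at most `-2 F ^ 2 log F`. -/
theorem level_one_inequality (u : (ι → Bool) → ℝ) (h0 : ∀ z, 0 ≤ u z) (h1 : ∀ z, u z ≤ 1) :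
    ∑ j, (𝔼 z, u z * bitSign (z j)) ^ 2 ≤ 2 * (𝔼 z, u z) * negMulLog (𝔼 z, u z) := by
  set F := 𝔼 z, u z with hF
  set c : ι → ℝ := fun j => 𝔼 z, u z * bitSign (z j) with hc
  have hF0 : 0 ≤ F := expect_nonneg fun z _ => h0 z
  rcases hF0.eq_or_lt with hz | hpos
  · have hu : ∀ z, u z = 0 := by
      intro z
      have := (expect_eq_zero_iff_of_nonneg (fun z _ => h0 z)).1 (hF.symm.trans hz.symm)
      exact this z (mem_univ z)
    have : ∀ j, c j = 0 := by intro j; simp [hc, hu]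
    change ∑ j, c j ^ 2 ≤ _
    simp [this, ← hz]
  -- `c j / F` is the bias of bit `j` under the density `u / F`. Using it as exponential tilt, the
  -- exponent has mean `B` under that density.
  set B := ∑ j, (c j / F) ^ 2 with hB
  -- Jensen's inequality for the density `u / F`, in the form of the tangent to `exp` at the mean
  -- `B`.
  have key1 : F * exp B ≤ 𝔼 z, u z * exp (∑ j, c j / F * bitSign (z j)) := by
    have hpt : ∀ z, u z * (exp B * (1 + (∑ j, c j / F * bitSign (z j)) - B)) ≤
        u z * exp (∑ j, c j / F * bitSign (z j)) := by
      intro z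
      refine mul_le_mul_of_nonneg_left ?_ (h0 z)
      set t := ∑ j, c j / F * bitSign (z j)
      have : exp t = exp B * exp (t - B) := by rw [← exp_add]; ring_nf
      rw [this]
      refine mul_le_mul_of_nonneg_left ?_ (exp_pos B).le
      have := add_one_le_exp (t - B)
      linarith
    refine le_trans (le_of_eq ?_) (expect_le_expect fun z _ => hpt z)
    have hlin : 𝔼 z, u z * (∑ j, c j / F * bitSign (z j)) = F * B := by
      simp_rw [mul_sum]
      rw [expect_sum_comm, hB, mul_sum]
      refine sum_congr rfl fun j _ => ?_
      have : ∀ z, u z * (c j / F * bitSign (z j)) = c j / F * (u z * bitSign (z j)) :=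
        fun z => by ring
      simp_rw [this]
      rw [← mul_expect]
      change c j / F * c j = _
      field_simp
    have : ∀ z, u z * (exp B * (1 + (∑ j, c j / F * bitSign (z j)) - B)) =
        exp B * (u z * (∑ j, c j / F * bitSign (z j))) + exp B * (1 - B) * u z :=
      fun z => by ring
    simp_rw [this]
    rw [expect_add_distrib, ← mul_expect, ← mul_expect, hlin, ← hF]
    ring
  -- Here `u ≤ 1` replaces the density by the uniform measure; with `key1` this gives `B ≤ -2 log
  -- F`.
  have key2 : 𝔼 z, u z * exp (∑ j, c j / F * bitSign (z j)) ≤ exp (B / 2) := by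
    calc _ ≤ 𝔼 z : ι → Bool, exp (∑ j, c j / F * bitSign (z j)) :=
          expect_le_expect fun z _ => mul_le_of_le_one_left (exp_pos _).le (h1 z)
      _ = ∏ j, cosh (c j / F) := expect_exp_sign _
      _ ≤ ∏ j, exp ((c j / F) ^ 2 / 2) :=
          prod_le_prod (fun j _ => (cosh_pos _).le) fun j _ => cosh_le_exp_half_sq _
      _ = exp (B / 2) := by rw [← exp_sum, hB, sum_div]
  have hlog : log F + B ≤ B / 2 := by
    have := log_le_log (by positivity) (key1.trans key2)
    rwa [log_mul hpos.ne' (exp_pos _).ne', log_exp, log_exp] at this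
  have hsum : ∑ j, c j ^ 2 = F ^ 2 * B := by
    rw [hB, mul_sum]
    refine sum_congr rfl fun j _ => ?_
    field_simp
  change ∑ j, c j ^ 2 ≤ _
  rw [hsum, negMulLog]
  have : F ^ 2 * B ≤ F ^ 2 * (-2 * log F) :=
    mul_le_mul_of_nonneg_left (by linarith) (by positivity)
  linarith

/-- The mean of `w` over the subcube spanned by the coordinates in `D`, when coordinate `j` is
replaced by `a` and all the others are `false`. -/
noncomputable def subcubeMean (w : (ι → Bool) → ℝ) (D : ι → Bool) (j : ι) (a : Bool) : ℝ :=
  𝔼 z : ι → Bool, w (Function.update (fun i => D i && z i) j a)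

theorem subcubeMean_nonneg {w : (ι → Bool) → ℝ} (h0 : ∀ z, 0 ≤ w z) (D : ι → Bool) (j : ι)
    (a : Bool) : 0 ≤ subcubeMean w D j a :=
  expect_nonneg fun _ _ => h0 _

/-- Coordinate `j` is overwritten anyway, so a mask and its flip at `j` give the same means. This
allows the two masks to be treated together below. -/
theorem subcubeMean_update (w : (ι → Bool) → ℝ) (D : ι → Bool) (j : ι) (a b : Bool) :
    subcubeMean w (Function.update D j b) j a = subcubeMean w D j a := by
  unfold subcubeMean
  refine expect_congr rfl fun z _ => congrArg w ?_
  ext i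
  by_cases h : i = j
  · subst h; simp
  · simp [h]

theorem subcubeMean_false {w : (ι → Bool) → ℝ} {D : ι → Bool} {j : ι} (hD : D j = false) :
    subcubeMean w D j false = 𝔼 z : ι → Bool, w (fun i => D i && z i) := by
  unfold subcubeMean
  refine expect_congr rfl fun z _ => congrArg w ?_
  ext i
  by_cases h : i = j
  · subst h; simp [hD]
  · simp [h]

theorem mask_update {ι : Type*} [DecidableEq ι] {D : ι → Bool} {j : ι} (hD : D j = true) (z : ι → Bool) (a : Bool) :
    (fun i => D i && Function.update z j a i) = Function.update (fun i => D i && z i) j a := by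
  ext i
  by_cases h : i = j
  · subst h; simp [hD]
  · simp [h]

theorem subcubeMean_add {w : (ι → Bool) → ℝ} {D : ι → Bool} {j : ι} (hD : D j = true) :
    𝔼 z : ι → Bool, w (fun i => D i && z i) =
      (subcubeMean w D j false + subcubeMean w D j true) / 2 := by
  rw [expect_split j]
  simp_rw [mask_update hD]
  rfl

/-- The effect of coordinate `j` is a level-one Fourier coefficient of the restricted function, the
quantity bounded by `level_one_inequality`. -/
theorem subcubeMean_sub {w : (ι → Bool) → ℝ} {D : ι → Bool} {j : ι} (hD : D j = true) :
    𝔼 z : ι → Bool, w (fun i => D i && z i) * bitSign (z j) =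
      (subcubeMean w D j true - subcubeMean w D j false) / 2 := by
  rw [expect_split j]
  simp_rw [mask_update hD]
  simp only [Function.update_self, bitSign, if_true, mul_one, Bool.false_eq_true, if_false,
    mul_neg, expect_neg_distrib]
  simp only [subcubeMean]
  ring

theorem sq_sqrt_sub_sqrt_mul_le {x y : ℝ} (hx : 0 ≤ x) (hy : 0 ≤ y) :
    (√x - √y) ^ 2 * (x + y) ≤ (x - y) ^ 2 := by
  have h1 := sq_sqrt hx
  have h2 := sq_sqrt hy
  have h3 : (x - y) ^ 2 = (√x - √y) ^ 2 * (√x + √y) ^ 2 := by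
    rw [← mul_pow]; congr 1; nlinarith
  rw [h3]
  refine mul_le_mul_of_nonneg_left ?_ (sq_nonneg _)
  nlinarith [mul_nonneg (sqrt_nonneg x) (sqrt_nonneg y)]

/-- The two means at `j` have sum 2F and difference twice the Fourier coefficient c, so the squared
difference of their roots is at most (2c)² / (2F) = 2c² / F; the level-one inequality bounds the sum
of the c². -/
theorem sum_hellinger_le {w : (ι → Bool) → ℝ} (h0 : ∀ z, 0 ≤ w z) (h1 : ∀ z, w z ≤ 1)
    (D : ι → Bool) :
    ∑ j, (if D j then (√(subcubeMean w D j false) - √(subcubeMean w D j true)) ^ 2 else 0) ≤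
      4 * negMulLog (𝔼 z : ι → Bool, w (fun i => D i && z i)) := by
  set F := 𝔼 z : ι → Bool, w (fun i => D i && z i) with hF
  have hF0 : 0 ≤ F := expect_nonneg fun z _ => h0 _
  have hF1 := level_one_inequality (fun z => w (fun i => D i && z i)) (fun _ => h0 _) fun _ => h1 _
  rw [← hF] at hF1
  rcases hF0.eq_or_lt with hz | hpos
  · rw [← hz]
    simp only [negMulLog_zero, mul_zero]
    refine le_of_eq (sum_eq_zero fun j _ => ?_)
    split_ifs with hD
    · have h := subcubeMean_add (w := w) hD
      rw [← hF, ← hz] at h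
      have ha := subcubeMean_nonneg h0 D j false
      have hb := subcubeMean_nonneg h0 D j true
      rw [show subcubeMean w D j false = 0 by linarith, show subcubeMean w D j true = 0 by linarith]
      simp
    · rfl
  · have hterm : ∀ j, (if D j then
        (√(subcubeMean w D j false) - √(subcubeMean w D j true)) ^ 2 else 0) ≤
        2 / F * (𝔼 z : ι → Bool, w (fun i => D i && z i) * bitSign (z j)) ^ 2 := by
      intro j
      split_ifs with hD
      · have h := sq_sqrt_sub_sqrt_mul_le (subcubeMean_nonneg h0 D j false)
          (subcubeMean_nonneg h0 D j true)
        have hs := subcubeMean_add (w := w) hD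
        rw [subcubeMean_sub hD]
        rw [← hF] at hs
        rw [show subcubeMean w D j false + subcubeMean w D j true = 2 * F by linarith] at h
        rw [div_mul_eq_mul_div, le_div_iff₀ hpos]
        nlinarith
      · positivity
    refine (sum_le_sum fun j _ => hterm j).trans ?_
    rw [← mul_sum]
    refine (mul_le_mul_of_nonneg_left hF1 (by positivity)).trans (le_of_eq ?_)
    field_simp
    ring

/-- Entropy is maximal for the uniform distribution; pointwise this is `log x ≤ x - 1` at x = 1 / (K
α). -/
theorem sum_negMulLog_le {τ : Type*} [Fintype τ] (α : τ → ℝ) (h0 : ∀ t, 0 ≤ α t)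
    (h1 : ∑ t, α t = 1) : ∑ t, negMulLog (α t) ≤ log (Fintype.card τ) := by
  have hne : Nonempty τ := by
    by_contra h
    rw [not_nonempty_iff] at h
    simp at h1
  have hK : (0 : ℝ) < Fintype.card τ := by exact_mod_cast Fintype.card_pos
  set K : ℝ := (Fintype.card τ : ℝ) with hKdef
  have hpt : ∀ t, negMulLog (α t) ≤ 1 / K - α t + α t * log K := by
    intro t
    rcases (h0 t).eq_or_lt with hz | hpos
    · rw [← hz]; simp [hK.le]
    · have := log_le_sub_one_of_pos (show 0 < 1 / (K * α t) by positivity)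
      rw [one_div, log_inv, log_mul hK.ne' hpos.ne'] at this
      have h2 := mul_le_mul_of_nonneg_left this hpos.le
      have h3 : α t * ((K * α t)⁻¹ - 1) = 1 / K - α t := by field_simp
      rw [negMulLog]
      linarith
  refine (sum_le_sum fun t _ => hpt t).trans (le_of_eq ?_)
  rw [sum_add_distrib, sum_sub_distrib, ← sum_mul, h1]
  simp [K]

variable {τ : Type*} [Fintype τ]

/-- A randomized transcript on the four inputs `(a, b)` whose probability is a product `f a * g b`
has the cut-and-paste property, so `(0, 0)` and `(1, 1)` cannot be told apart better than
`(0, 0)` from `(1, 0)` and from `(0, 1)`. -/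
theorem cut_and_paste (f g : Bool → τ → ℝ) (hf : ∀ a t, 0 ≤ f a t) (hg : ∀ a t, 0 ≤ g a t)
    (hfg : ∀ a b, ∑ t, f a t * g b t = 1) (S : Finset τ) {δ : ℝ} (hδ : 0 < δ) :
    ∑ t ∈ S, (f false t * g false t - f true t * g true t) ≤
      δ + 2 / δ * ((∑ t, g false t * (√(f false t) - √(f true t)) ^ 2) +
        ∑ t, f false t * (√(g false t) - √(g true t)) ^ 2) := by
  set p : Bool → τ → ℝ := fun a t => √(f a t) with hp
  set q : Bool → τ → ℝ := fun a t => √(g a t) with hq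
  have hpf : ∀ a t, f a t = p a t ^ 2 := fun a t => (sq_sqrt (hf a t)).symm
  have hqg : ∀ a t, g a t = q a t ^ 2 := fun a t => (sq_sqrt (hg a t)).symm
  have hpn : ∀ a t, 0 ≤ p a t := fun a t => sqrt_nonneg _
  have hqn : ∀ a t, 0 ≤ q a t := fun a t => sqrt_nonneg _
  have hfg' : ∀ a b, ∑ t, (p a t * q b t) ^ 2 = 1 := by
    intro a b
    rw [← hfg a b]
    exact sum_congr rfl fun t _ => by rw [hpf, hqg, mul_pow]
  -- Both squares have the same cross term, the product of all four roots, and all square terms sum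
  -- to 1.
  have hH : ∑ t, (p false t * q false t - p true t * q true t) ^ 2 =
      ∑ t, (p true t * q false t - p false t * q true t) ^ 2 := by
    have h1 : ∀ t, (p false t * q false t - p true t * q true t) ^ 2 =
      (p true t * q false t - p false t * q true t) ^ 2 +
        ((p false t * q false t) ^ 2 + (p true t * q true t) ^ 2 - (p true t * q false t) ^ 2 -
          (p false t * q true t) ^ 2) := fun t => by ring
    simp_rw [h1]
    rw [sum_add_distrib, sum_sub_distrib, sum_sub_distrib, sum_add_distrib]
    simp_rw [hfg']
    ring
  have hH2 : ∑ t, (p true t * q false t - p false t * q true t) ^ 2 ≤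
      2 * ((∑ t, g false t * (p false t - p true t) ^ 2) +
        ∑ t, f false t * (q false t - q true t) ^ 2) := by
    rw [← sum_add_distrib, mul_sum]
    refine sum_le_sum fun t _ => ?_
    rw [hpf, hqg]
    nlinarith [sq_nonneg (q false t * (p false t - p true t) + p false t * (q false t - q true t)),
      sq_nonneg (q false t * (p false t - p true t) - p false t * (q false t - q true t))]
  -- Factor x² - y² = (x - y)(x + y), then apply the weighted arithmetic-geometric inequality and (x
  -- + y)² ≤ 2(x² + y²).
  have hpt : ∀ t, f false t * g false t - f true t * g true t ≤
      (p false t * q false t - p true t * q true t) ^ 2 / δ +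
        δ / 2 * ((p false t * q false t) ^ 2 + (p true t * q true t) ^ 2) := by
    intro t
    rw [hpf, hpf, hqg, hqg]
    set x := p false t * q false t
    set y := p true t * q true t
    have h1 : p false t ^ 2 * q false t ^ 2 - p true t ^ 2 * q true t ^ 2 = (x - y) * (x + y) := by
      simp only [x, y]; ring
    rw [h1, div_add' _ _ _ hδ.ne', le_div_iff₀ hδ]
    nlinarith [sq_nonneg ((x - y) - δ / 2 * (x + y)), mul_nonneg (sq_nonneg δ) (sq_nonneg (x - y))]
  calc _ ≤ ∑ t ∈ S, ((p false t * q false t - p true t * q true t) ^ 2 / δ +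
        δ / 2 * ((p false t * q false t) ^ 2 + (p true t * q true t) ^ 2)) :=
        sum_le_sum fun t _ => hpt t
    _ ≤ ∑ t, ((p false t * q false t - p true t * q true t) ^ 2 / δ +
        δ / 2 * ((p false t * q false t) ^ 2 + (p true t * q true t) ^ 2)) :=
        sum_le_sum_of_subset_of_nonneg (subset_univ S) fun t _ _ => by positivity
    _ = (∑ t, (p false t * q false t - p true t * q true t) ^ 2) / δ + δ := by
        rw [sum_add_distrib, ← sum_div, ← mul_sum, sum_add_distrib, hfg', hfg']; ring
    _ ≤ 2 * ((∑ t, g false t * (p false t - p true t) ^ 2) +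
        ∑ t, f false t * (q false t - q true t) ^ 2) / δ + δ := by
        rw [hH]; gcongr
    _ = _ := by ring

theorem sum_flip (j : ι) (φ : (ι → Bool) → ℝ) :
    ∑ D, φ (Function.update D j (!D j)) = ∑ D, φ D := by
  have hinv : Function.Involutive (fun z : ι → Bool => Function.update z j (!z j)) := by
    intro z; simp
  exact Fintype.sum_equiv hinv.toPerm _ _ (fun _ => rfl)

theorem not_update {ι : Type*} [DecidableEq ι] (D : ι → Bool) (j : ι) (b : Bool) :
    (fun i => !(Function.update D j b i)) = Function.update (fun i => !D i) j (!b) := by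
  ext i
  by_cases h : i = j
  · subst h; simp
  · simp [h]

/-- Disjointness lower bound: if the transcripts form a (fractional) partition of the pairs of
inputs into `card τ` rectangles, then acceptance of a random disjoint pair and of a random uniquely
intersecting pair have nearly the same probability unless `log (card τ)` is linear in `card ι`. -/
theorem disjointness_bound (u v : τ → (ι → Bool) → ℝ) (hu0 : ∀ t z, 0 ≤ u t z)
    (hu1 : ∀ t z, u t z ≤ 1) (hv0 : ∀ t z, 0 ≤ v t z) (hv1 : ∀ t z, v t z ≤ 1)
    (huv : ∀ x y, ∑ t, u t x * v t y = 1) (S : Finset τ) {δ : ℝ} (hδ : 0 < δ) :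
    ∑ j, ∑ D : ι → Bool, ∑ t ∈ S,
      (subcubeMean (u t) D j false * subcubeMean (v t) (fun i => !D i) j false -
        subcubeMean (u t) D j true * subcubeMean (v t) (fun i => !D i) j true) ≤
      (Fintype.card ι * δ + 16 / δ * log (Fintype.card τ)) * Fintype.card (ι → Bool) := by
  set f : (ι → Bool) → ι → Bool → τ → ℝ := fun D j a t => subcubeMean (u t) D j a with hf
  set g : (ι → Bool) → ι → Bool → τ → ℝ :=
    fun D j a t => subcubeMean (v t) (fun i => !D i) j a with hg
  have hf0 : ∀ D j a t, 0 ≤ f D j a t := fun D j a t => subcubeMean_nonneg (hu0 t) D j a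
  have hg0 : ∀ D j a t, 0 ≤ g D j a t := fun D j a t => subcubeMean_nonneg (hv0 t) _ j a
  have hexp : ∀ (X Y : (ι → Bool) → (ι → Bool)),
      ∑ t, (𝔼 z, u t (X z)) * (𝔼 z, v t (Y z)) = 1 := by
    intro X Y
    simp_rw [expect_mul_expect]
    rw [← expect_sum_comm]
    simp_rw [← expect_sum_comm, huv]
    simp
  have hfg : ∀ D j a b, ∑ t, f D j a t * g D j b t = 1 := fun D j a b => hexp _ _
  -- The effect of changing `j` for the player to whom `D` assigns `j`, the other player keeping
  -- `false` there.
  set h : (ι → Bool) → ι → ℝ := fun D j => if D j then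
      ∑ t, g D j false t * (√(f D j false t) - √(f D j true t)) ^ 2
    else ∑ t, f D j false t * (√(g D j false t) - √(g D j true t)) ^ 2 with hh
  -- Cut-and-paste needs the effects for both players: one is charged to `D`, the other to its flip
  -- at `j`.
  have hstep : ∀ D j, ∑ t ∈ S, (f D j false t * g D j false t - f D j true t * g D j true t) ≤
      δ + 2 / δ * (h D j + h (Function.update D j (!D j)) j) := by
    intro D j
    have hfu : ∀ b, f (Function.update D j b) j = f D j := by
      intro b; funext a t; exact subcubeMean_update _ _ _ _ _
    have hgu : ∀ b, g (Function.update D j b) j = g D j := by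
      intro b; funext a t
      simp only [hg, not_update]
      exact subcubeMean_update _ _ _ _ _
    have := cut_and_paste (f D j) (g D j) (hf0 D j) (hg0 D j) (hfg D j) S hδ
    refine this.trans (le_of_eq ?_)
    simp only [hh, hfu, hgu, Function.update_self]
    cases D j <;> simp [add_comm]
  have hD : ∀ D, ∑ j, h D j ≤ 4 * log (Fintype.card τ) := by
    intro D
    set F : τ → ℝ := fun t => 𝔼 z : ι → Bool, u t (fun i => D i && z i) with hF
    set G : τ → ℝ := fun t => 𝔼 z : ι → Bool, v t (fun i => (!D i) && z i) with hG
    have hF0 : ∀ t, 0 ≤ F t := fun t => expect_nonneg fun _ _ => hu0 _ _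
    have hG0 : ∀ t, 0 ≤ G t := fun t => expect_nonneg fun _ _ => hv0 _ _
    have e1 : ∀ j, h D j = ∑ t,
        (G t * (if D j then (√(f D j false t) - √(f D j true t)) ^ 2 else 0) +
          F t * (if !D j then (√(g D j false t) - √(g D j true t)) ^ 2 else 0)) := by
      intro j
      simp only [hh]
      cases hDj : D j
      · simp only [Bool.false_eq_true, if_false, mul_zero, zero_add, Bool.not_false, if_true]
        refine sum_congr rfl fun t _ => ?_
        rw [show f D j false t = F t from subcubeMean_false hDj]
      · simp only [if_true, Bool.not_true, Bool.false_eq_true, if_false, mul_zero, add_zero]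
        refine sum_congr rfl fun t _ => ?_
        rw [show g D j false t = G t from subcubeMean_false (by simp [hDj])]
    simp_rw [e1]
    rw [sum_comm]
    have e2 : ∀ t, ∑ j,
        (G t * (if D j then (√(f D j false t) - √(f D j true t)) ^ 2 else 0) +
          F t * (if !D j then (√(g D j false t) - √(g D j true t)) ^ 2 else 0)) ≤
        4 * negMulLog (F t * G t) := by
      intro t
      -- `negMulLog (F * G) = G * negMulLog F + F * negMulLog G` matches the weights `G t` and `F t`
      -- of the two players.
      rw [sum_add_distrib, ← mul_sum, ← mul_sum, negMulLog_mul]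
      have a1 := mul_le_mul_of_nonneg_left (sum_hellinger_le (hu0 t) (hu1 t) D) (hG0 t)
      have a2 := mul_le_mul_of_nonneg_left (sum_hellinger_le (hv0 t) (hv1 t) (fun i => !D i)) (hF0 t)
      linarith
    refine (sum_le_sum fun t _ => e2 t).trans ?_
    rw [← mul_sum]
    refine mul_le_mul_of_nonneg_left (sum_negMulLog_le _ (fun t => mul_nonneg (hF0 t) (hG0 t)) ?_)
      (by norm_num)
    exact hexp _ _
  calc _ ≤ ∑ j, ∑ D : ι → Bool, (δ + 2 / δ * (h D j + h (Function.update D j (!D j)) j)) :=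
        sum_le_sum fun j _ => sum_le_sum fun D _ => hstep D j
    _ = ∑ j, (Fintype.card (ι → Bool) * δ + 4 / δ * ∑ D, h D j) := by
        refine sum_congr rfl fun j _ => ?_
        rw [sum_add_distrib, ← mul_sum, sum_add_distrib, sum_flip j (fun D => h D j)]
        rw [sum_const, nsmul_eq_mul, Finset.card_univ]
        ring
    _ = Fintype.card ι * Fintype.card (ι → Bool) * δ + 4 / δ * ∑ D, ∑ j, h D j := by
        rw [sum_add_distrib, sum_const, ← mul_sum, sum_comm, nsmul_eq_mul, Finset.card_univ]
        ring
    _ ≤ Fintype.card ι * Fintype.card (ι → Bool) * δ +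
        4 / δ * ∑ _D : ι → Bool, 4 * log (Fintype.card τ) := by
        gcongr with D; exact hD D
    _ = _ := by
        rw [sum_const, nsmul_eq_mul, Finset.card_univ]; ring

/-- Disjointness lower bound for transcript functions whose fibers are rectangles. The disjoint and
the uniquely intersecting pairs of inputs are obtained by splitting the coordinates between the
players according to `D` and setting coordinate `j` of both inputs to `false` or to `true`. -/
theorem disjointness_transcript_bound [DecidableEq τ] (T : (ι → Bool) → (ι → Bool) → τ)
    (hT : ∀ x y x' y', T x y = T x' y' → T x y' = T x y) (S : Finset τ) {δ : ℝ} (hδ : 0 < δ) :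
    ∑ j, ∑ D : ι → Bool, ∑ z : ι → Bool, ∑ z' : ι → Bool,
      ((if T (Function.update (fun i => D i && z i) j false)
          (Function.update (fun i => (!D i) && z' i) j false) ∈ S then (1 : ℝ) else 0) -
        (if T (Function.update (fun i => D i && z i) j true)
          (Function.update (fun i => (!D i) && z' i) j true) ∈ S then (1 : ℝ) else 0)) ≤
      (Fintype.card ι * δ + 16 / δ * log (Fintype.card τ)) * Fintype.card (ι → Bool) ^ 3 := by
  classical
  -- Indicators of the two sides of the rectangle of `t`; `hT` says that their product is the
  -- indicator of the fiber.
  set u : τ → (ι → Bool) → ℝ := fun t x => if ∃ y, T x y = t then 1 else 0 with hu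
  set v : τ → (ι → Bool) → ℝ := fun t y => if ∃ x, T x y = t then 1 else 0 with hv
  have hrect : ∀ t x y, u t x * v t y = if T x y = t then 1 else 0 := by
    intro t x y
    by_cases h : T x y = t
    · rw [if_pos h]
      simp only [hu, hv]
      rw [if_pos ⟨y, h⟩, if_pos ⟨x, h⟩, one_mul]
    · rw [if_neg h]
      simp only [hu, hv, ite_mul, one_mul, zero_mul]
      split_ifs with h1 h2
      · obtain ⟨y', h1⟩ := h1
        obtain ⟨x', h2⟩ := h2
        exact absurd ((hT x y' x' y (h1.trans h2.symm)).trans h1) h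
      · rfl
      · rfl
  have hS : ∀ x y, (if T x y ∈ S then (1 : ℝ) else 0) = ∑ t ∈ S, u t x * v t y := by
    intro x y
    simp_rw [hrect]
    rw [Finset.sum_ite_eq]
  have hN : (0 : ℝ) < Fintype.card (ι → Bool) := by exact_mod_cast Fintype.card_pos
  have hmean : ∀ D j a, ∑ z : ι → Bool, ∑ z' : ι → Bool,
      (if T (Function.update (fun i => D i && z i) j a)
          (Function.update (fun i => (!D i) && z' i) j a) ∈ S then (1 : ℝ) else 0) =
      (∑ t ∈ S, subcubeMean (u t) D j a * subcubeMean (v t) (fun i => !D i) j a) *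
        Fintype.card (ι → Bool) ^ 2 := by
    intro D j a
    have hmul : ∀ t, subcubeMean (u t) D j a * subcubeMean (v t) (fun i => !D i) j a *
        (Fintype.card (ι → Bool) : ℝ) ^ 2 = ∑ z : ι → Bool, ∑ z' : ι → Bool,
          u t (Function.update (fun i => D i && z i) j a) *
            v t (Function.update (fun i => (!D i) && z' i) j a) := by
      intro t
      rw [← Finset.sum_mul_sum, subcubeMean, subcubeMean, Fintype.expect_eq_sum_div_card,
        Fintype.expect_eq_sum_div_card]
      field_simp
    simp_rw [hS]
    rw [sum_mul]
    simp_rw [hmul]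
    exact (sum_comm.trans (sum_congr rfl fun z _ => sum_comm)).symm
  have hmain := disjointness_bound u v
    (fun t z => by simp only [hu]; split_ifs <;> norm_num)
    (fun t z => by simp only [hu]; split_ifs <;> norm_num)
    (fun t z => by simp only [hv]; split_ifs <;> norm_num)
    (fun t z => by simp only [hv]; split_ifs <;> norm_num)
    (fun x y => by simp_rw [hrect]; simp) S hδ
  have := mul_le_mul_of_nonneg_right hmain (sq_nonneg (Fintype.card (ι → Bool) : ℝ))
  refine (le_of_eq ?_).trans (this.trans (le_of_eq (by ring)))
  simp_rw [sum_sub_distrib, hmean]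
  rw [sub_mul, sum_mul, sum_mul]
  simp_rw [sum_mul]

end Disjointness

/-! ### Labels -/

theorem partBits_length (a : Fin 4) : (partBits a).length = 2 := by
  fin_cases a <;> rfl

theorem partBits_injective : Function.Injective partBits := by
  decide

theorem indexBits_injective {n : ℕ} : Function.Injective (indexBits (n := n)) := by
  intro i j h
  have := congrFun (List.ofFn_injective h) i
  simpa using this

/-- The blocks of a label have lengths fixed by `n` and the part, so they can be separated. Only
outer labels determine an index and a row. -/
theorem disjLabel_inj {n : ℕ} {X Y X' Y' : Fin n → Fin n → Bool} {a a' : Fin 4} {i i' : Fin n}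
    (h : disjLabel X Y (a, i) = disjLabel X' Y' (a', i')) :
    a = a' ∧ (a = 0 → i = i' ∧ X i = X' i') ∧ (a = 3 → i = i' ∧ Y i = Y' i') := by
  obtain ⟨h1, h2⟩ := List.append_inj h (by simp [partBits_length])
  have ha : a = a' := partBits_injective h1
  subst ha
  refine ⟨rfl, ?_, ?_⟩
  · rintro rfl
    obtain ⟨h3, h4⟩ := List.append_inj h2 (by simp [indexBits])
    exact ⟨indexBits_injective h3, List.ofFn_injective h4⟩
  · rintro rfl
    obtain ⟨h3, h4⟩ := List.append_inj h2 (by simp [indexBits])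
    exact ⟨indexBits_injective h3, List.ofFn_injective h4⟩

/-! ### Hard instances -/

/-- The four-layer graph with labeling `ℓ_{X,Y}`, on the node set `Fin (4 * n)`. -/
def disjInstance {n : ℕ} (hn : 0 < n) (X Y : Fin n → Fin n → Bool) : LabeledGraph where
  size := 4 * n
  size_pos := by omega
  graph := (fourLayerGraph n).comap finProdFinEquiv.symm
  label v := disjLabel X Y (finProdFinEquiv.symm v)

/-- An isomorphism may permute the nodes, but the outer labels carry the indices, so X and Y are
determined by the labeled graph. -/
theorem disjInstance_mem {n : ℕ} (hn : 0 < n) {X Y : Fin n → Fin n → Bool} :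
    disjInstance hn X Y ∈ disjFourLayer ↔ Disj X Y := by
  constructor
  · rintro ⟨n', X', Y', e, hd, hl⟩
    have hcard : Fintype.card (Fin (4 * n)) = Fintype.card (Fin 4 × Fin n') :=
      Fintype.card_congr e.toEquiv
    simp only [Fintype.card_fin, Fintype.card_prod] at hcard
    obtain rfl : n = n' := by omega
    have h0 : ∀ i, X i = X' i := by
      intro i
      have := hl (finProdFinEquiv (0, i))
      simp only [disjInstance, Equiv.symm_apply_apply] at this
      obtain ⟨h1, h2, -⟩ := disjLabel_inj (this.trans (congrArg _ (Prod.mk.eta).symm))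
      obtain ⟨h3, h4⟩ := h2 rfl
      rw [h4, ← h3]
    have h1 : ∀ i, Y i = Y' i := by
      intro i
      have := hl (finProdFinEquiv (3, i))
      simp only [disjInstance, Equiv.symm_apply_apply] at this
      obtain ⟨h1, -, h2⟩ := disjLabel_inj (this.trans (congrArg _ (Prod.mk.eta).symm))
      obtain ⟨h3, h4⟩ := h2 rfl
      rw [h4, ← h3]
    rw [funext h0, funext h1]
    exact hd
  · intro h
    exact ⟨n, X, Y, ⟨finProdFinEquiv.symm, Iff.rfl⟩, h, fun _ => rfl⟩

/-! ### Reduction of LOCAL and BCC rounds to a two-party protocol. -/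

namespace HybridAlgorithm

variable {Ω : Type} (A : HybridAlgorithm Ω)

/-- The effect of a BCC round on the states of the nodes. -/
def bccStep {m : ℕ} (ident : Fin m → ℕ) (s : Fin m → A.State m) : Fin m → A.State m :=
  fun v => A.recv (s v) (Finset.univ.image fun u => (ident u, A.bccMsg (s u)))

theorem run_replicate_bccRound (I : LabeledGraph) (ident : Fin I.size → ℕ) (k : ℕ)
    (s : Fin I.size → A.State I.size) :
    A.run I ident (List.replicate k .bccRound) s = (A.bccStep ident)^[k] s := by
  induction k generalizing s with
  | zero => rfl
  | succ k ih =>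
    rw [List.replicate_succ, run, ih, Function.iterate_succ_apply]
    congr 1

/-- If two runs broadcast the same messages, then a run that starts as the first one on one side
and as the second one on the other side continues in this way. -/
theorem bccStep_iterate_exchange {m : ℕ} (ident : Fin m → ℕ) (P : Fin m → Prop)
    {s s' s'' : Fin m → A.State m} (h1 : ∀ v, P v → s'' v = s v) (h2 : ∀ v, ¬ P v → s'' v = s' v)
    {k : ℕ} (hmsg : ∀ r < k, ∀ v,
      A.bccMsg ((A.bccStep ident)^[r] s v) = A.bccMsg ((A.bccStep ident)^[r] s' v)) :
    ∀ r ≤ k, (∀ v, P v → (A.bccStep ident)^[r] s'' v = (A.bccStep ident)^[r] s v) ∧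
      (∀ v, ¬ P v → (A.bccStep ident)^[r] s'' v = (A.bccStep ident)^[r] s' v) := by
  intro r hr
  induction r with
  | zero => exact ⟨h1, h2⟩
  | succ r ih =>
    obtain ⟨i1, i2⟩ := ih (by omega)
    have hm := hmsg r (by omega)
    simp only [Function.iterate_succ_apply']
    set t := (A.bccStep ident)^[r] s
    set t' := (A.bccStep ident)^[r] s'
    set t'' := (A.bccStep ident)^[r] s''
    have hmm : ∀ v, A.bccMsg (t'' v) = A.bccMsg (t v) := by
      intro v
      by_cases hv : P v
      · rw [i1 v hv]
      · rw [i2 v hv, hm]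
    refine ⟨fun v hv => ?_, fun v hv => ?_⟩
    · simp only [bccStep, hmm, i1 v hv]
    · simp only [bccStep, hmm, hm, i2 v hv]

/-- The identifier of a node is one more than its number. -/
def succIdent {m : ℕ} (v : Fin m) : ℕ := v.val + 1

/-- The states after the LOCAL round on a hard instance. -/
noncomputable def localState {n : ℕ} (hn : 0 < n) (ω : Ω) (X Y : Fin n → Fin n → Bool) :
    Fin (4 * n) → A.State (4 * n) :=
  A.run (disjInstance hn X Y) succIdent [.localRound]
    (A.initial (disjInstance hn X Y) succIdent ω)

/-- A node is on the left side if it belongs to one of the first two parts. -/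
def LeftSide {n : ℕ} (v : Fin (4 * n)) : Prop := (finProdFinEquiv.symm v).1.val ≤ 1

theorem localState_congr {n : ℕ} (hn : 0 < n) (ω : Ω) {X Y X' Y' : Fin n → Fin n → Bool}
    (v : Fin (4 * n))
    (h : ∀ u, u = v ∨ (fourLayerGraph n).Adj (finProdFinEquiv.symm v) (finProdFinEquiv.symm u) →
      disjLabel X Y (finProdFinEquiv.symm u) = disjLabel X' Y' (finProdFinEquiv.symm u)) :
    A.localState hn ω X Y v = A.localState hn ω X' Y' v := by
  have hinit : ∀ u, u = v ∨
      (fourLayerGraph n).Adj (finProdFinEquiv.symm v) (finProdFinEquiv.symm u) →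
      A.initial (disjInstance hn X Y) succIdent ω u =
        A.initial (disjInstance hn X' Y') succIdent ω u := by
    intro u hu
    change A.init _ _ _ _ (disjLabel X Y _) = A.init _ _ _ _ (disjLabel X' Y' _)
    rw [h u hu]
    rfl
  simp only [localState, run]
  refine congrArg₂ _ (hinit v (Or.inl rfl)) ?_
  simp only [inbox]
  refine Finset.image_congr fun u hu => ?_
  have hu' : (fourLayerGraph n).Adj (finProdFinEquiv.symm v) (finProdFinEquiv.symm u) := by
    classical
    have h' := (Finset.mem_filter.1 (Finset.mem_coe.1 hu)).2
    exact h'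
  exact congrArg (fun s => (succIdent u, A.localMsg s (succIdent v))) (hinit u (Or.inr hu'))

/-- Neighbors of V₁ ∪ V₂ lie in the first three parts, and labels in V₃ do not depend on Y. -/
theorem localState_left {n : ℕ} (hn : 0 < n) (ω : Ω) (X Y Y' : Fin n → Fin n → Bool)
    {v : Fin (4 * n)} (hv : LeftSide v) :
    A.localState hn ω X Y v = A.localState hn ω X Y' v := by
  refine A.localState_congr hn ω v fun u hu => ?_
  have hlt : (finProdFinEquiv.symm u).1.val ≤ 2 := by
    unfold LeftSide at hv
    rcases hu with rfl | hu
    · omega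
    · simp only [fourLayerGraph] at hu; omega
  generalize finProdFinEquiv.symm u = p at hlt ⊢
  obtain ⟨a, i⟩ := p
  fin_cases a
  · rfl
  · rfl
  · rfl
  · simp at hlt

theorem localState_right {n : ℕ} (hn : 0 < n) (ω : Ω) (X X' Y : Fin n → Fin n → Bool)
    {v : Fin (4 * n)} (hv : ¬ LeftSide v) :
    A.localState hn ω X Y v = A.localState hn ω X' Y v := by
  refine A.localState_congr hn ω v fun u hu => ?_
  have hlt : 1 ≤ (finProdFinEquiv.symm u).1.val := by
    unfold LeftSide at hv
    rcases hu with rfl | hu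
    · omega
    · simp only [fourLayerGraph] at hu; omega
  generalize finProdFinEquiv.symm u = p at hlt ⊢
  obtain ⟨a, i⟩ := p
  fin_cases a
  · simp at hlt
  · rfl
  · rfl
  · rfl

/-- The states after the LOCAL round and `r` BCC rounds on a hard instance. -/
noncomputable def bccState {n : ℕ} (hn : 0 < n) (ω : Ω) (r : ℕ) (X Y : Fin n → Fin n → Bool) :
    Fin (4 * n) → A.State (4 * n) :=
  (A.bccStep succIdent)^[r] (A.localState hn ω X Y)

open Classical in
/-- All the bits broadcast during `k` BCC rounds with messages of length at most `L`, and the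
conjunctions of the decisions on either side. -/
noncomputable def transcript {n : ℕ} (hn : 0 < n) (ω : Ω) (k L : ℕ)
    (X Y : Fin n → Fin n → Bool) :
    (Fin k → Fin (4 * n) → Fin L → Option Bool) × Bool × Bool :=
  (fun r v l => (A.bccMsg (A.bccState hn ω r X Y v))[l.val]?,
    decide (∀ v, LeftSide v → A.accept (A.bccState hn ω k X Y v) = true),
    decide (∀ v, ¬ LeftSide v → A.accept (A.bccState hn ω k X Y v) = true))

theorem transcript_exchange {n : ℕ} (hn : 0 < n) (ω : Ω) {k L : ℕ}
    (hL : ∀ s : A.State (4 * n), (A.bccMsg s).length ≤ L) {X Y X' Y' : Fin n → Fin n → Bool}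
    (h : A.transcript hn ω k L X Y = A.transcript hn ω k L X' Y') :
    A.transcript hn ω k L X Y' = A.transcript hn ω k L X Y := by
  obtain ⟨hm, hacc⟩ := Prod.ext_iff.1 h
  obtain ⟨-, hB⟩ := Prod.ext_iff.1 hacc
  have hmsg : ∀ r < k, ∀ v, A.bccMsg (A.bccState hn ω r X Y v) =
      A.bccMsg (A.bccState hn ω r X' Y' v) := by
    intro r hr v
    refine List.ext_getElem? fun l => ?_
    -- The transcript records the first `L` positions, with `none` past the end of a message; by
    -- `hL` nothing lies beyond.
    by_cases hl : l < L
    · exact congrFun (congrFun (congrFun hm ⟨r, hr⟩) v) ⟨l, hl⟩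
    · rw [List.getElem?_eq_none ((hL _).trans (not_lt.1 hl)),
        List.getElem?_eq_none ((hL _).trans (not_lt.1 hl))]
  have key := A.bccStep_iterate_exchange succIdent LeftSide
    (s := A.localState hn ω X Y) (s' := A.localState hn ω X' Y') (s'' := A.localState hn ω X Y')
    (fun v hv => A.localState_left hn ω X Y' Y hv)
    (fun v hv => A.localState_right hn ω X X' Y' hv) hmsg
  unfold transcript at hB ⊢
  refine Prod.ext ?_ (Prod.ext ?_ ?_)
  · funext r v l
    simp only
    by_cases hv : LeftSide v
    · have := (key r r.2.le).1 v hv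
      simp only [bccState] at this ⊢
      rw [this]
    · have h1 := (key r r.2.le).2 v hv
      have h2 := hmsg r r.2 v
      simp only [bccState] at h1 h2 ⊢
      rw [h1, h2]
  · simp only [decide_eq_decide]
    refine forall₂_congr fun v hv => ?_
    have := (key k le_rfl).1 v hv
    simp only [bccState]
    rw [this]
  -- The right side behaves as on (X', Y'), whose right verdict equals that on (X, Y) by hypothesis.
  · refine Eq.trans ?_ hB.symm
    simp only [decide_eq_decide]
    refine forall₂_congr fun v hv => ?_
    have := (key k le_rfl).2 v hv
    simp only [bccState]
    rw [this]

theorem allAccept_iff_transcript {n : ℕ} (hn : 0 < n) (ω : Ω) (k L : ℕ)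
    (X Y : Fin n → Fin n → Bool) :
    A.AllAccept (scheduleLB k) (disjInstance hn X Y) succIdent ω ↔
      (A.transcript hn ω k L X Y).2 = (true, true) := by
  have hrun : A.run (disjInstance hn X Y) succIdent (scheduleLB k)
      (A.initial (disjInstance hn X Y) succIdent ω) = A.bccState hn ω k X Y := by
    rw [scheduleLB, run, run_replicate_bccRound]
    rfl
  unfold AllAccept
  rw [hrun]
  simp only [transcript, Prod.mk.injEq, decide_eq_true_eq]
  constructor
  · intro h
    exact ⟨fun v _ => h v, fun v _ => h v⟩
  · rintro ⟨h1, h2⟩ v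
    by_cases hv : LeftSide v
    · exact h1 v hv
    · exact h2 v hv

theorem log_card_transcript_le (m k L : ℕ) :
    Real.log (Fintype.card ((Fin k → Fin m → Fin L → Option Bool) × Bool × Bool)) ≤
      2 * (k * m * L) + 3 := by
  simp only [Fintype.card_prod, Fintype.card_pi, Finset.prod_const, Finset.card_univ,
    Fintype.card_fin, Fintype.card_option, Fintype.card_bool]
  push_cast
  rw [Real.log_mul (by positivity) (by norm_num), Real.log_pow, Real.log_pow, Real.log_pow]
  have h3 : Real.log 3 ≤ 2 := by
    have := Real.log_le_sub_one_of_pos (show (0 : ℝ) < 3 by norm_num); linarith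
  have h4 : Real.log 4 ≤ 3 := by
    have := Real.log_le_sub_one_of_pos (show (0 : ℝ) < 4 by norm_num); linarith
  have : (k : ℝ) * (m * (L * Real.log 3)) ≤ k * (m * (L * 2)) := by gcongr
  linarith

end HybridAlgorithm

/-! ### The lower bound for randomized and deterministic algorithms. -/

theorem disj_curry_false {n : ℕ} (D z z' : Fin n × Fin n → Bool) (j : Fin n × Fin n) :
    Disj (Function.curry (Function.update (fun i => D i && z i) j false))
      (Function.curry (Function.update (fun i => (!D i) && z' i) j false)) := by
  rintro ⟨a, b, h1, h2⟩
  simp only [Function.curry] at h1 h2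
  by_cases h : (a, b) = j
  · subst h; simp at h1
  · rw [Function.update_of_ne h] at h1 h2
    cases hD : D (a, b) <;> simp [hD] at h1 h2

theorem not_disj_curry_true {n : ℕ} (x y : Fin n × Fin n → Bool) (j : Fin n × Fin n) :
    ¬ Disj (Function.curry (Function.update x j true))
      (Function.curry (Function.update y j true)) := by
  refine not_not.2 ⟨j.1, j.2, ?_, ?_⟩ <;> simp [Function.curry]

open Finset in
/-- A randomized algorithm that performs one LOCAL round and `k` BCC rounds with messages of length
`L` cannot decide `disjFourLayer` on graphs with `4 * n` nodes unless `k * L` is linear in `n`. -/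
theorem randomized_tradeoff {Ω : Type} [MeasurableSpace Ω] {μ : Measure Ω} [IsProbabilityMeasure μ]
    {A : HybridAlgorithm Ω} {N : ℕ → ℕ} (hN : IsIdRange N) {ε : ℝ} (hε : 0 < ε) {k : ℕ}
    (hA : A.DecidesWithError μ (1 / 2 - ε) N (scheduleLB k) disjFourLayer) {n L : ℕ} (hn : 0 < n)
    (hL : ∀ s : A.State (4 * n), (A.bccMsg s).length ≤ L) :
    ε ^ 2 * n ^ 2 ≤ 16 * (2 * (k * (4 * n) * L) + 3) := by
  classical
  have hid : IsIdAssignment N (HybridAlgorithm.succIdent (m := 4 * n)) := by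
    refine ⟨fun v w h => Fin.ext (Nat.succ_injective h), fun v => ⟨Nat.succ_pos _, ?_⟩⟩
    exact (Nat.succ_le_of_lt v.2).trans (hN.1 _)
  set acc : (Fin n × Fin n → Bool) → (Fin n × Fin n → Bool) → Set Ω := fun x y =>
    {ω | A.AllAccept (scheduleLB k) (disjInstance hn (Function.curry x) (Function.curry y))
      HybridAlgorithm.succIdent ω} with hacc
  have hmeas : ∀ x y, MeasurableSet (acc x y) := fun x y => (hA _ _ hid).1
  have hyes : ∀ x y, Disj (Function.curry x) (Function.curry y) → 1 / 2 + ε ≤ μ.real (acc x y) := by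
    intro x y h
    have : 1 - (1 / 2 - ε) ≤ μ.real (acc x y) := (hA _ _ hid).2.1 ((disjInstance_mem hn).2 h)
    linarith
  have hno : ∀ x y, ¬ Disj (Function.curry x) (Function.curry y) →
      μ.real (acc x y) ≤ 1 / 2 - ε := by
    intro x y h
    have h1 := (hA _ _ hid).2.2 (fun h' => h ((disjInstance_mem hn).1 h'))
    have h2 := probReal_compl_eq_one_sub (μ := μ) (hmeas x y)
    change _ ≤ μ.real (acc x y)ᶜ at h1
    linarith
  have hint : ∀ x y, Integrable ((acc x y).indicator (fun _ => (1 : ℝ))) μ := fun x y =>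
    (integrable_const _).indicator (hmeas x y)
  have hval : ∀ x y, ∫ ω, (acc x y).indicator (fun _ => (1 : ℝ)) ω ∂μ = μ.real (acc x y) :=
    fun x y => by rw [integral_indicator_const _ (hmeas x y)]; simp
  set K : ℝ := (Fintype.card (Fin n × Fin n → Bool) : ℝ) with hK
  have hKpos : 0 < K := by rw [hK]; exact_mod_cast Fintype.card_pos
  set τ := (Fin k → Fin (4 * n) → Fin L → Option Bool) × Bool × Bool
  set C : ℝ := (Fintype.card (Fin n × Fin n) * ε + 16 / ε * Real.log (Fintype.card τ)) * K ^ 3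
  -- For a fixed seed the algorithm is deterministic, so the transcript bound applies; integration
  -- over the seed follows.
  have hpt : ∀ ω, ∑ j : Fin n × Fin n, ∑ D : Fin n × Fin n → Bool,
      ∑ z : Fin n × Fin n → Bool, ∑ z' : Fin n × Fin n → Bool,
      ((acc (Function.update (fun i => D i && z i) j false)
          (Function.update (fun i => (!D i) && z' i) j false)).indicator (fun _ => (1 : ℝ)) ω -
        (acc (Function.update (fun i => D i && z i) j true)
          (Function.update (fun i => (!D i) && z' i) j true)).indicator (fun _ => (1 : ℝ)) ω) ≤
        C := by
    intro ω
    have h := disjointness_transcript_bound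
      (fun x y => A.transcript hn ω k L (Function.curry x) (Function.curry y))
      (fun x y x' y' h => A.transcript_exchange hn ω hL h)
      (univ.filter fun t => t.2 = (true, true)) hε
    refine (le_of_eq ?_).trans h
    have hind : ∀ x y, (acc x y).indicator (fun _ => (1 : ℝ)) ω =
        if A.transcript hn ω k L (Function.curry x) (Function.curry y) ∈
          univ.filter (fun t : τ => t.2 = (true, true)) then 1 else 0 := by
      intro x y
      rw [Set.indicator_apply]
      refine if_congr ?_ rfl rfl
      rw [mem_filter]
      simp only [mem_univ, true_and]
      exact A.allAccept_iff_transcript hn ω k L _ _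
    refine sum_congr rfl fun j _ => sum_congr rfl fun D _ => sum_congr rfl fun z _ =>
      sum_congr rfl fun z' _ => ?_
    rw [hind, hind]
  have hintegral : ∑ j : Fin n × Fin n, ∑ D : Fin n × Fin n → Bool,
      ∑ z : Fin n × Fin n → Bool, ∑ z' : Fin n × Fin n → Bool,
      (μ.real (acc (Function.update (fun i => D i && z i) j false)
          (Function.update (fun i => (!D i) && z' i) j false)) -
        μ.real (acc (Function.update (fun i => D i && z i) j true)
          (Function.update (fun i => (!D i) && z' i) j true))) ≤ C := by
    have h := integral_mono (μ := μ) (integrable_finsetSum _ fun j _ => integrable_finsetSum _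
      fun D _ => integrable_finsetSum _ fun z _ => integrable_finsetSum _ fun z' _ =>
        (hint _ _).sub (hint _ _)) (integrable_const C) hpt
    simp only [integral_const, probReal_univ, one_smul] at h
    refine (le_of_eq ?_).trans h
    rw [integral_finsetSum _ fun j _ => integrable_finsetSum _
      fun D _ => integrable_finsetSum _ fun z _ => integrable_finsetSum _ fun z' _ =>
        (hint _ _).sub (hint _ _)]
    refine sum_congr rfl fun j _ => ?_
    rw [integral_finsetSum _ fun D _ => integrable_finsetSum _ fun z _ =>
      integrable_finsetSum _ fun z' _ => (hint _ _).sub (hint _ _)]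
    refine sum_congr rfl fun D _ => ?_
    rw [integral_finsetSum _ fun z _ =>
      integrable_finsetSum _ fun z' _ => (hint _ _).sub (hint _ _)]
    refine sum_congr rfl fun z _ => ?_
    rw [integral_finsetSum _ fun z' _ => (hint _ _).sub (hint _ _)]
    refine sum_congr rfl fun z' _ => ?_
    rw [integral_sub' (hint _ _) (hint _ _), hval, hval]
  -- Acceptance probabilities differ by at least (1/2 + ε) - (1/2 - ε) = 2ε. The choice δ = ε loses
  -- only half of this gap.
  have hlow : (Fintype.card (Fin n × Fin n) : ℝ) * (2 * ε) * K ^ 3 ≤ C := by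
    refine le_trans (le_of_eq (b := ∑ _j : Fin n × Fin n, ∑ _D : Fin n × Fin n → Bool,
      ∑ _z : Fin n × Fin n → Bool, ∑ _z' : Fin n × Fin n → Bool, 2 * ε) ?_)
      ((sum_le_sum fun j _ => sum_le_sum fun D _ =>
        sum_le_sum fun z _ => sum_le_sum fun z' _ => ?_).trans hintegral)
    · simp only [sum_const, nsmul_eq_mul, Finset.card_univ, ← hK]; ring
    · have h1 := hyes _ _ (disj_curry_false D z z' j)
      have h2 := hno _ _ (not_disj_curry_true (fun i => D i && z i) (fun i => (!D i) && z' i) j)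
      linarith
  have hlow2 := le_of_mul_le_mul_right hlow (by positivity)
  have hcard : (Fintype.card (Fin n × Fin n) : ℝ) = n ^ 2 := by
    simp [sq]
  rw [hcard] at hlow2
  have hlog := HybridAlgorithm.log_card_transcript_le (4 * n) k L
  have h3 : (n : ℝ) ^ 2 * ε ≤ 16 / ε * Real.log (Fintype.card τ) := by linarith
  rw [div_mul_eq_mul_div, le_div_iff₀ hε] at h3
  push_cast at hlog
  nlinarith

theorem disjFourLayer_notMem_randClassLBStar {N : ℕ → ℕ} (hN : IsIdRange N) {ε : ℝ} (hε : 0 < ε) :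
    disjFourLayer ∉ randClassLBStar N (1 / 2 - ε) := by
  intro h
  obtain ⟨k, Ω, _, μ, _, A, ⟨c, hc⟩, hA⟩ := Set.mem_iUnion.1 h
  set C : ℝ := 16 * (8 * k * c + 3) with hC
  have hbound : ∀ t : ℕ, ε ^ 2 * 2 ^ t ≤ C * (t + 3) := by
    intro t
    have hlog : Nat.log 2 (4 * 2 ^ t) = t + 2 := by
      rw [show 4 * 2 ^ t = 2 ^ (t + 2) by ring]
      exact Nat.log_pow (by norm_num) _
    -- Powers of two make the bandwidth exact: `Nat.log 2 (4 * 2 ^ t) + 1 = t + 3`.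
    have hb := randomized_tradeoff hN hε hA (n := 2 ^ t) (L := c * (t + 3)) (by positivity)
      (fun s => by simpa [hlog, add_assoc] using (hc _ s).2)
    push_cast at hb
    have hp : (1 : ℝ) ≤ 2 ^ t := one_le_pow₀ (by norm_num)
    have h2 : ε ^ 2 * 2 ^ t * 2 ^ t ≤ C * (t + 3) * 2 ^ t := by
      have : (1 : ℝ) ≤ 2 ^ t * (t + 3) := by nlinarith [(Nat.cast_nonneg t : (0 : ℝ) ≤ t)]
      rw [hC]
      nlinarith
    exact le_of_mul_le_mul_right h2 (by positivity)
  have hlim : Filter.Tendsto (fun t : ℕ => C * ((t : ℝ) ^ 1 / 2 ^ t + 3 * (1 / 2) ^ t))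
      Filter.atTop (nhds (C * (0 + 3 * 0))) :=
    ((tendsto_pow_const_div_const_pow_of_one_lt 1 (by norm_num : (1 : ℝ) < 2)).add
      ((tendsto_pow_atTop_nhds_zero_of_lt_one (by norm_num) (by norm_num)).const_mul 3)).const_mul C
  have hlt : C * (0 + 3 * 0) < ε ^ 2 := by
    simp only [mul_zero, add_zero]; positivity
  obtain ⟨t, ht⟩ := (hlim.eventually_lt_const hlt).exists
  have hb := hbound t
  have hp : (0 : ℝ) < 2 ^ t := by positivity
  have h4 := mul_lt_mul_of_pos_right ht hp
  have h5 : C * ((t : ℝ) ^ 1 / 2 ^ t + 3 * (1 / 2) ^ t) * 2 ^ t = C * (t + 3) := by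
    rw [one_div, inv_pow, pow_one]
    field_simp
  linarith

theorem disjFourLayer_notMem_classLBStar {N : ℕ → ℕ} (hN : IsIdRange N) :
    disjFourLayer ∉ classLBStar N := by
  intro h
  obtain ⟨k, A, hA, hdec⟩ := Set.mem_iUnion.1 h
  -- A deterministic algorithm is a randomized one with a trivial seed and error 1/2 - 1/2 = 0.
  refine disjFourLayer_notMem_randClassLBStar hN (ε := 1 / 2) (by norm_num)
    (Set.mem_iUnion.2 ⟨k, Unit, inferInstance, Measure.dirac (), inferInstance, A, hA, ?_⟩)
  intro I ident hid
  have hiff := hdec I ident hid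
  refine ⟨MeasurableSet.of_discrete, fun hI => ?_, fun hI => ?_⟩
  · have : {ω : Unit | A.AllAccept (scheduleLB k) I ident ω} = Set.univ := by
      ext; simpa using hiff.1 hI
    rw [this]; simp
  · have : {ω : Unit | ¬ A.AllAccept (scheduleLB k) I ident ω} = Set.univ := by
      ext; simpa using fun h => hI (hiff.2 h)
    rw [this]; simp

/-! ### Packets and local computations -/

/-- The content of a message: the part and the index of a node, a column, and the bit in this column
of the row of the node. -/
abbrev Packet (n : ℕ) := Fin 4 × Fin n × Fin n × Bool

/-- The binary encoding of a packet. -/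
noncomputable def packetBits {n : ℕ} (p : Packet n) : List Bool :=
  Nat.bits ((Fintype.equivFin (Packet n) p).val + 1)

theorem packetBits_injective {n : ℕ} : Function.Injective (packetBits (n := n)) := by
  intro p q h
  have h1 : (Fintype.equivFin (Packet n) p).val = (Fintype.equivFin (Packet n) q).val := by
    have := congrArg (fun l => Nat.ofDigits 2 (l.map fun b => cond b 1 0)) h
    simp only [packetBits, ← Nat.digits_two_eq_bits, Nat.ofDigits_digits] at this
    exact Nat.succ_injective this
  exact (Fintype.equivFin (Packet n)).injective (Fin.ext h1)

/-- Due to the shift by one in `packetBits`; the empty message can thus mean that there is no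
packet. -/
theorem packetBits_ne_nil {n : ℕ} (p : Packet n) : packetBits p ≠ [] := by
  intro h
  have := Nat.size_eq_bits_len ((Fintype.equivFin (Packet n) p).val + 1)
  rw [packetBits] at h
  rw [h, List.length_nil, eq_comm, Nat.size_eq_zero] at this
  omega

theorem packetBits_length_le {m : ℕ} (p : Packet (m / 4)) :
    (packetBits p).length ≤ 2 * (Nat.log 2 m + 1) := by
  rw [packetBits, Nat.size_eq_bits_len, Nat.size_le]
  refine (Nat.succ_le_of_lt (Fintype.equivFin (Packet (m / 4)) p).2).trans_lt ?_
  simp only [Fintype.card_prod, Fintype.card_fin, Fintype.card_bool]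
  have h1 : m < 2 ^ (Nat.log 2 m + 1) := Nat.lt_pow_succ_log_self (by norm_num) m
  have h2 : 4 * (m / 4) ≤ m := Nat.mul_div_le m 4
  rw [mul_comm 2, pow_mul]
  have h3 := Nat.mul_le_mul h2 h2
  have h4 := Nat.mul_lt_mul'' h1 h1
  rw [sq]
  nlinarith [Nat.zero_le (m / 4 * (m / 4))]

open Classical in
/-- The part, the index and the row that a label encodes. -/
noncomputable def parseLabel (n : ℕ) (l : List Bool) : Option (Fin 4 × Fin n × (Fin n → Bool)) :=
  if h : ∃ r : Fin 4 × Fin n × (Fin n → Bool),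
    l = disjLabel (fun _ => r.2.2) (fun _ => r.2.2) (r.1, r.2.1) then some h.choose else none

theorem eq_disjLabel_of_parseLabel {n : ℕ} {l : List Bool} {r : Fin 4 × Fin n × (Fin n → Bool)}
    (h : parseLabel n l = some r) :
    l = disjLabel (fun _ => r.2.2) (fun _ => r.2.2) (r.1, r.2.1) := by
  unfold parseLabel at h
  split_ifs at h with h'
  obtain rfl := Option.some.inj h
  exact h'.choose_spec

theorem exists_parseLabel {n : ℕ} (X Y : Fin n → Fin n → Bool) (v : Fin 4 × Fin n) :
    ∃ r, parseLabel n (disjLabel X Y v) = some r := by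
  have h : ∃ r : Fin 4 × Fin n × (Fin n → Bool), disjLabel X Y v =
      disjLabel (fun _ => r.2.2) (fun _ => r.2.2) (r.1, r.2.1) := by
    obtain ⟨a, i⟩ := v
    fin_cases a
    · exact ⟨(0, i, X i), rfl⟩
    -- Inner labels carry neither index nor row, so these values are fillers.
    · exact ⟨(1, i, X i), rfl⟩
    · exact ⟨(2, i, X i), rfl⟩
    · exact ⟨(3, i, Y i), rfl⟩
  exact ⟨_, dif_pos h⟩

/-- The number of elements of `S` that are smaller than `d`. -/
def rankIn (S : Finset ℕ) (d : ℕ) : ℕ := (S.filter (· < d)).card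

theorem rankIn_lt {S : Finset ℕ} {d : ℕ} (hd : d ∈ S) : rankIn S d < S.card :=
  Finset.card_lt_card (Finset.filter_ssubset.2 ⟨d, hd, lt_irrefl d⟩)

theorem rankIn_injOn (S : Finset ℕ) : Set.InjOn (rankIn S) S := by
  have hlt : ∀ d ∈ S, ∀ d', d < d' → rankIn S d < rankIn S d' := by
    intro d hd d' hdd
    refine Finset.card_lt_card (Finset.ssubset_iff_of_subset ?_ |>.2 ⟨d, ?_, ?_⟩)
    · intro x hx
      rw [Finset.mem_filter] at hx ⊢
      exact ⟨hx.1, hx.2.trans hdd⟩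
    · exact Finset.mem_filter.2 ⟨hd, hdd⟩
    · simp
  intro d hd d' hd' h
  rcases lt_trichotomy d d' with h1 | h1 | h1
  · exact absurd h (hlt d hd d' h1).ne
  · exact h1
  · exact absurd h (hlt d' hd' d h1).ne'

theorem exists_rankIn_eq {S : Finset ℕ} {j : ℕ} (hj : j < S.card) : ∃ d ∈ S, rankIn S d = j := by
  have := Finset.surjOn_of_injOn_of_card_le (s := S) (t := Finset.range S.card) (rankIn S)
    (fun d hd => Finset.mem_coe.2 (Finset.mem_range.2 (rankIn_lt hd))) (rankIn_injOn S) (by simp)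
  exact this (Finset.mem_coe.2 (Finset.mem_range.2 hj))

/-- The packet sent to the neighbor `dest` in the first round by a node with set of neighbors `S`.
The nodes of `V₄` send to their `k`-th neighbor the `k`-th bit of their row, and those of `V₁` use a
cyclic shift that depends on their index. -/
def firstPacket {n : ℕ} (S : Finset ℕ) (r : Fin 4 × Fin n × (Fin n → Bool)) (dest : ℕ) :
    Packet n :=
  let c : Fin n := ⟨((if r.1 = 3 then 0 else r.2.1.val) + rankIn S dest) % n, Nat.mod_lt _ r.2.1.pos⟩
  (r.1, r.2.1, c, r.2.2 c)

/-- The message sent to the neighbor `dest` in the first round. -/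
noncomputable def firstMsg (n : ℕ) (S : Finset ℕ) (l : List Bool) (dest : ℕ) : List Bool :=
  (parseLabel n l).elim [] fun r => packetBits (firstPacket S r dest)

open Classical in
/-- The senders of messages from part `a`. -/
noncomputable def senders (n : ℕ) (M : Finset (ℕ × List Bool)) (a : Fin 4) : Finset ℕ :=
  (M.filter fun q => ∃ i c b, q.2 = packetBits ((a, i, c, b) : Packet n)).image Prod.fst

/-- The packet `p` with bit `1` comes from `V₁`, and its column is the rank of `dest` in `V₃`. -/
def IsForwarded (n : ℕ) (M : Finset (ℕ × List Bool)) (dest : ℕ) (p : Packet n) : Prop :=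
  p.1 = 0 ∧ p.2.2.2 = true ∧ p.2.2.1.val = rankIn (senders n M 2) dest ∧
    ∃ id, (id, packetBits p) ∈ M

open Classical in
/-- The message sent to the neighbor `dest` in the second round, after receiving `M`. -/
noncomputable def secondMsg (n : ℕ) (M : Finset (ℕ × List Bool)) (dest : ℕ) : List Bool :=
  if h : ∃ p, IsForwarded n M dest p then packetBits h.choose else []

/-- Parts `a` and `b` are consecutive. -/
def LayerAdj (a b : Fin 4) : Prop := a.val + 1 = b.val ∨ b.val + 1 = a.val

instance : DecidableRel LayerAdj := fun a b => by unfold LayerAdj; infer_instance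

/-- The acceptance condition of a node with label `l` that received `M₁` and `M₂`. -/
def LocallyValid (n : ℕ) (l : List Bool) (M₁ M₂ : Finset (ℕ × List Bool)) : Prop :=
  ∃ r, parseLabel n l = some r ∧
    (∀ b, (senders n M₁ b).card = if LayerAdj r.1 b then n else 0) ∧
    (r.1 = 1 → ∀ i, ∃ id c b, (id, packetBits ((0, i, c, b) : Packet n)) ∈ M₁) ∧
    (r.1 = 2 → ∀ i, ∃ id c b, (id, packetBits ((3, i, c, b) : Packet n)) ∈ M₁) ∧
    (r.1 = 2 → ∀ i c c' id id', (id, packetBits ((3, i, c, true) : Packet n)) ∈ M₁ →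
      (id', packetBits ((0, i, c', true) : Packet n)) ∉ M₂)

/-- The identifiers of its neighbors, the label, and the messages received so far by a node. -/
structure ViewState where
  nbrs : Finset ℕ
  label : List Bool
  inboxes : List (Finset (ℕ × List Bool))

open Classical in
/-- The algorithm that decides `disjFourLayer` in two CONGEST rounds. -/
noncomputable def congestAlgorithm : HybridAlgorithm Unit where
  State _ := ViewState
  init _ _ _ S l := ⟨S, l, []⟩
  localMsg _ _ := []
  congestMsg {m} s dest := match s.inboxes with
    | [] => firstMsg (m / 4) s.nbrs s.label dest
    | M :: _ => secondMsg (m / 4) M dest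
  bccMsg _ := []
  recv s M := ⟨s.nbrs, s.label, s.inboxes ++ [M]⟩
  accept {m} s := match s.inboxes with
    | [M₁, M₂] => decide (LocallyValid (m / 4) s.label M₁ M₂)
    | _ => false

theorem congestAlgorithm_boundedBandwidth : congestAlgorithm.BoundedBandwidth := by
  refine ⟨2, fun m s => ⟨fun dest => ?_, Nat.zero_le _⟩⟩
  obtain ⟨S, l, Ms⟩ := s
  cases Ms with
  | nil =>
    change (firstMsg (m / 4) S l dest).length ≤ _
    unfold firstMsg
    cases parseLabel (m / 4) l with
    | none => exact Nat.zero_le _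
    | some r => exact packetBits_length_le _
  | cons M Ms =>
    change (secondMsg (m / 4) M dest).length ≤ _
    unfold secondMsg
    split_ifs
    · exact packetBits_length_le _
    · exact Nat.zero_le _

/-! ### The run of the algorithm -/

section Run

variable (I : LabeledGraph) (ident : Fin I.size → ℕ)

open Classical in
/-- The messages received by `v` in the first round. -/
noncomputable def firstInbox (v : Fin I.size) : Finset (ℕ × List Bool) :=
  (Finset.univ.filter fun u => I.graph.Adj v u).image fun u =>
    (ident u, firstMsg (I.size / 4) ((Finset.univ.filter fun w => I.graph.Adj u w).image ident)
      (I.label u) (ident v))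

open Classical in
/-- The messages received by `v` in the second round. -/
noncomputable def secondInbox (v : Fin I.size) : Finset (ℕ × List Bool) :=
  (Finset.univ.filter fun u => I.graph.Adj v u).image fun u =>
    (ident u, secondMsg (I.size / 4) (firstInbox I ident u) (ident v))

theorem congestAlgorithm_allAccept_iff :
    congestAlgorithm.AllAccept [.congestRound, .congestRound] I ident () ↔
      ∀ v, LocallyValid (I.size / 4) (I.label v) (firstInbox I ident v)
        (secondInbox I ident v) := by
  refine forall_congr' fun v => ?_
  classical
  simp only [congestAlgorithm, HybridAlgorithm.run, HybridAlgorithm.initial]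
  exact decide_eq_true_iff

end Run

/-- The graph is a four-layer graph with `size / 4` nodes in each part, and `r` gives the part, the
index and the row of each node, as read from its label. -/
structure IsLayered (I : LabeledGraph)
    (r : Fin I.size → Fin 4 × Fin (I.size / 4) × (Fin (I.size / 4) → Bool)) : Prop where
  parse : ∀ v, parseLabel (I.size / 4) (I.label v) = some (r v)
  card_part : ∀ a, (Finset.univ.filter fun v => (r v).1 = a).card = I.size / 4
  adj_iff : ∀ u v, I.graph.Adj u v ↔ LayerAdj (r u).1 (r v).1

/-! ### What the two CONGEST rounds deliver, and what the local checks certify. -/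

section Inboxes

variable {I : LabeledGraph} {ident : Fin I.size → ℕ}
  {r : Fin I.size → Fin 4 × Fin (I.size / 4) × (Fin (I.size / 4) → Bool)}

open Classical in
theorem mem_firstInbox (hr : ∀ v, parseLabel (I.size / 4) (I.label v) = some (r v))
    {v : Fin I.size} {q : ℕ × List Bool} :
    q ∈ firstInbox I ident v ↔ ∃ u, I.graph.Adj v u ∧ q = (ident u, packetBits (firstPacket
      ((Finset.univ.filter fun w => I.graph.Adj u w).image ident) (r u) (ident v))) := by
  simp only [firstInbox, Finset.mem_image, Finset.mem_filter, Finset.mem_univ, true_and, firstMsg,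
    hr, Option.elim_some]
  exact exists_congr fun u => and_congr_right fun _ => eq_comm

/-- Only parsable labels are needed, not a layered graph, so local counts become degrees while the
layered structure is still to be proved. -/
theorem senders_firstInbox (hr : ∀ v, parseLabel (I.size / 4) (I.label v) = some (r v))
    [DecidableRel I.graph.Adj] (v : Fin I.size) (a : Fin 4) :
    senders (I.size / 4) (firstInbox I ident v) a =
      (Finset.univ.filter fun u => I.graph.Adj v u ∧ (r u).1 = a).image ident := by
  ext d
  simp only [senders, Finset.mem_image, Finset.mem_filter, Finset.mem_univ, true_and,
    mem_firstInbox hr]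
  constructor
  · rintro ⟨q, ⟨⟨u, hu, rfl⟩, i, c, b, h⟩, rfl⟩
    have := congrArg Prod.fst (packetBits_injective h)
    exact ⟨u, ⟨hu, this⟩, rfl⟩
  · rintro ⟨u, ⟨hu, rfl⟩, rfl⟩
    exact ⟨_, ⟨⟨u, hu, rfl⟩, _, _, _, rfl⟩, rfl⟩

/-- The identifiers of the nodes of part `a`. -/
def partIds (ident : Fin I.size → ℕ)
    (r : Fin I.size → Fin 4 × Fin (I.size / 4) × (Fin (I.size / 4) → Bool)) (a : Fin 4) :
    Finset ℕ :=
  (Finset.univ.filter fun v => (r v).1 = a).image ident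

theorem mem_partIds (v : Fin I.size) : ident v ∈ partIds ident r (r v).1 :=
  Finset.mem_image_of_mem _ (by simp)

theorem IsLayered.card_partIds (h : IsLayered I r) (hid : Function.Injective ident) (a : Fin 4) :
    (partIds ident r a).card = I.size / 4 := by
  rw [partIds, Finset.card_image_of_injective _ hid, h.card_part]

/-- For nodes of an outer part: all of them have the same neighborhood, hence agree on the ranks of
the recipients. -/
theorem IsLayered.nbrs_eq [DecidableRel I.graph.Adj] (h : IsLayered I r) {u : Fin I.size}
    {a : Fin 4} (ha : ∀ b, LayerAdj (r u).1 b ↔ b = a) :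
    (Finset.univ.filter fun w => I.graph.Adj u w).image ident = partIds ident r a := by
  unfold partIds
  congr 1
  ext w
  simp [h.adj_iff, ha]

/-- This is how a node of V₂ learns the ranks in V₃. -/
theorem IsLayered.senders_eq (h : IsLayered I r) {v : Fin I.size} {a : Fin 4}
    (ha : LayerAdj (r v).1 a) :
    senders (I.size / 4) (firstInbox I ident v) a = partIds ident r a := by
  classical
  rw [senders_firstInbox h.parse, partIds]
  congr 1
  ext w
  simp only [Finset.mem_filter, Finset.mem_univ, true_and, h.adj_iff, and_iff_right_iff_imp]
  rintro rfl
  exact ha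

theorem layerAdj_zero_iff (b : Fin 4) : LayerAdj 0 b ↔ b = 1 := by revert b; decide

theorem layerAdj_three_iff (b : Fin 4) : LayerAdj 3 b ↔ b = 2 := by revert b; decide

/-- The column of `X` and `Y` that a node is responsible for: its rank in its part. -/
def nodeRank (ident : Fin I.size → ℕ)
    (r : Fin I.size → Fin 4 × Fin (I.size / 4) × (Fin (I.size / 4) → Bool)) (v : Fin I.size) : ℕ :=
  rankIn (partIds ident r (r v).1) (ident v)

theorem IsLayered.nodeRank_lt (h : IsLayered I r) (hid : Function.Injective ident)
    (v : Fin I.size) : nodeRank ident r v < I.size / 4 := by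
  rw [← h.card_partIds hid (r v).1]
  exact rankIn_lt (mem_partIds v)

theorem IsLayered.exists_nodeRank_eq (h : IsLayered I r) (hid : Function.Injective ident)
    (a : Fin 4) {j : ℕ} (hj : j < I.size / 4) : ∃ v, (r v).1 = a ∧ nodeRank ident r v = j := by
  obtain ⟨d, hd, hj⟩ := exists_rankIn_eq (S := partIds ident r a) (j := j)
    (by rwa [h.card_partIds hid])
  obtain ⟨v, hv, rfl⟩ := Finset.mem_image.1 hd
  obtain rfl : (r v).1 = a := by simpa using hv
  exact ⟨v, rfl, hj⟩

theorem nodeRank_inj (hid : Function.Injective ident) {v w : Fin I.size}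
    (hvw : (r v).1 = (r w).1) (h : nodeRank ident r v = nodeRank ident r w) : v = w := by
  unfold nodeRank at h
  rw [hvw] at h
  exact hid (rankIn_injOn _ (hvw ▸ mem_partIds v) (mem_partIds w) h)

/-- What a node of `V₃` receives from `V₄` in the first round. -/
theorem IsLayered.mem_firstInbox_three (h : IsLayered I r) (hid : Function.Injective ident)
    {w : Fin I.size} (hw : (r w).1 = 2) {i c : Fin (I.size / 4)} :
    (∃ id, (id, packetBits ((3, i, c, true) : Packet _)) ∈ firstInbox I ident w) ↔
      c.val = nodeRank ident r w ∧ ∃ v, (r v).1 = 3 ∧ (r v).2.1 = i ∧ (r v).2.2 c = true := by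
  classical
  have hnbr : ∀ v, (r v).1 = 3 →
      (Finset.univ.filter fun w => I.graph.Adj v w).image ident = partIds ident r 2 :=
    fun v hv => h.nbrs_eq fun b => by rw [hv]; exact layerAdj_three_iff b
  have hmod := Nat.mod_eq_of_lt (h.nodeRank_lt hid w)
  have hrank : rankIn (partIds ident r 2) (ident w) = nodeRank ident r w := by
    rw [nodeRank, hw]
  have hpkt : ∀ v, (r v).1 = 3 → firstPacket (partIds ident r 2) (r v) (ident w) =
      (3, (r v).2.1, ⟨nodeRank ident r w, h.nodeRank_lt hid w⟩,
        (r v).2.2 ⟨nodeRank ident r w, h.nodeRank_lt hid w⟩) := by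
    intro v hv
    simp only [firstPacket, hv, if_true, zero_add, hrank, hmod]
  simp only [mem_firstInbox h.parse, Prod.mk.injEq]
  constructor
  · rintro ⟨id, v, hv, -, hp⟩
    have hp := packetBits_injective hp
    have hv3 : (r v).1 = 3 := (congrArg Prod.fst hp).symm
    rw [hnbr v hv3, hpkt v hv3] at hp
    simp only [Prod.mk.injEq, true_and] at hp
    obtain ⟨rfl, rfl, hb⟩ := hp
    exact ⟨rfl, v, hv3, rfl, hb.symm⟩
  · rintro ⟨hc, v, hv3, rfl, hb⟩
    obtain rfl : c = ⟨nodeRank ident r w, h.nodeRank_lt hid w⟩ := Fin.ext hc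
    refine ⟨_, v, ?_, rfl, ?_⟩
    · rw [h.adj_iff, hw, hv3]; decide
    · rw [hnbr v hv3, hpkt v hv3, hb]

theorem firstPacket_zero {n : ℕ} (S : Finset ℕ) {t : Fin 4 × Fin n × (Fin n → Bool)}
    (ht : t.1 = 0) (d : ℕ) {i c : Fin n} :
    ((0, i, c, true) : Packet n) = firstPacket S t d ↔
      t.2.1 = i ∧ c.val = (i.val + rankIn S d) % n ∧ t.2.2 c = true := by
  simp only [firstPacket, ht, Prod.mk.injEq, true_and]
  constructor
  · rintro ⟨rfl, rfl, h⟩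
    exact ⟨rfl, rfl, h.symm⟩
  · rintro ⟨rfl, hc, h⟩
    obtain rfl : c = ⟨(t.2.1.val + rankIn S d) % n, Nat.mod_lt _ t.2.1.pos⟩ := Fin.ext hc
    exact ⟨rfl, rfl, h.symm⟩

/-- What a node of `V₂` receives from `V₁` in the first round. -/
theorem IsLayered.mem_firstInbox_zero (h : IsLayered I r)
    {u : Fin I.size} (hu : (r u).1 = 1) {i c : Fin (I.size / 4)} :
    (∃ id, (id, packetBits ((0, i, c, true) : Packet _)) ∈ firstInbox I ident u) ↔
      c.val = (i.val + nodeRank ident r u) % (I.size / 4) ∧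
        ∃ v, (r v).1 = 0 ∧ (r v).2.1 = i ∧ (r v).2.2 c = true := by
  classical
  have hnbr : ∀ v, (r v).1 = 0 →
      (Finset.univ.filter fun w => I.graph.Adj v w).image ident = partIds ident r 1 :=
    fun v hv => h.nbrs_eq fun b => by rw [hv]; exact layerAdj_zero_iff b
  have hrank : rankIn (partIds ident r 1) (ident u) = nodeRank ident r u := by
    rw [nodeRank, hu]
  simp only [mem_firstInbox h.parse, Prod.mk.injEq]
  constructor
  · rintro ⟨id, v, hv, -, hp⟩
    have hp := packetBits_injective hp
    have hv0 : (r v).1 = 0 := (congrArg Prod.fst hp).symm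
    rw [hnbr v hv0, firstPacket_zero _ hv0, hrank] at hp
    exact ⟨hp.2.1, v, hv0, hp.1, hp.2.2⟩
  · rintro ⟨hc, v, hv0, hi, hb⟩
    refine ⟨_, v, ?_, rfl, ?_⟩
    · rw [h.adj_iff, hu, hv0]; decide
    · rw [hnbr v hv0, (firstPacket_zero _ hv0 _).2 ⟨hi, by rw [hrank]; exact hc, hb⟩]

/-- What a node of `V₂` forwards to a node of `V₃`. -/
theorem IsLayered.isForwarded_iff (h : IsLayered I r) {u w : Fin I.size} (hu : (r u).1 = 1)
    (hw : (r w).1 = 2) {p : Packet (I.size / 4)} :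
    IsForwarded (I.size / 4) (firstInbox I ident u) (ident w) p ↔
      ∃ i c, p = (0, i, c, true) ∧ c.val = nodeRank ident r w ∧
        c.val = (i.val + nodeRank ident r u) % (I.size / 4) ∧
        ∃ v, (r v).1 = 0 ∧ (r v).2.1 = i ∧ (r v).2.2 c = true := by
  have hs : senders (I.size / 4) (firstInbox I ident u) 2 = partIds ident r 2 :=
    h.senders_eq (by rw [hu]; decide)
  have hrank : rankIn (partIds ident r 2) (ident w) = nodeRank ident r w := by
    rw [nodeRank, hw]
  obtain ⟨a, i, c, b⟩ := p
  simp only [IsForwarded, hs, hrank, Prod.mk.injEq]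
  constructor
  · rintro ⟨rfl, rfl, hc, hm⟩
    obtain ⟨h1, h2⟩ := (h.mem_firstInbox_zero hu).1 hm
    exact ⟨i, c, ⟨rfl, rfl, rfl, rfl⟩, hc, h1, h2⟩
  · rintro ⟨i, c, ⟨rfl, rfl, rfl, rfl⟩, hc, h1, h2⟩
    exact ⟨rfl, rfl, hc, (h.mem_firstInbox_zero hu).2 ⟨h1, h2⟩⟩

theorem mem_secondInbox {v : Fin I.size} {q : ℕ × List Bool} :
    q ∈ secondInbox I ident v ↔ ∃ u, I.graph.Adj v u ∧
      q = (ident u, secondMsg (I.size / 4) (firstInbox I ident u) (ident v)) := by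
  simp only [secondInbox, Finset.mem_image, Finset.mem_filter, Finset.mem_univ, true_and]
  exact exists_congr fun u => and_congr_right fun _ => eq_comm

/-- The packets that reach a node of `V₃` from `V₂` in the second round are correct. -/
theorem IsLayered.of_mem_secondInbox (h : IsLayered I r) {w : Fin I.size} (hw : (r w).1 = 2)
    {i c : Fin (I.size / 4)} {id : ℕ}
    (hm : (id, packetBits ((0, i, c, true) : Packet _)) ∈ secondInbox I ident w) :
    c.val = nodeRank ident r w ∧ ∃ v, (r v).1 = 0 ∧ (r v).2.1 = i ∧ (r v).2.2 c = true := by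
  obtain ⟨u, hu, hq⟩ := mem_secondInbox.1 hm
  have hmsg := (Prod.ext_iff.1 hq).2
  simp only [secondMsg] at hmsg
  split_ifs at hmsg with hex
  · have hp := packetBits_injective hmsg
    have hf := hex.choose_spec
    rw [← hp] at hf
    have hadj := (h.adj_iff w u).1 hu
    have h13 : (r u).1 = 1 ∨ (r u).1 = 3 := by
      rw [hw] at hadj
      generalize (r u).1 = a at hadj
      revert a; decide
    rcases h13 with h1 | h3
    · obtain ⟨i', c', he, hc, -, hv⟩ := (h.isForwarded_iff h1 hw).1 hf
      simp only [Prod.mk.injEq, true_and, and_true] at he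
      obtain ⟨rfl, rfl⟩ := he
      exact ⟨hc, hv⟩
    -- A node of V₄ has nothing to forward, since it has no neighbor in V₁.
    · obtain ⟨id', hid'⟩ := hf.2.2.2
      obtain ⟨v, hv, hq⟩ := (mem_firstInbox h.parse).1 hid'
      have h0 : (r v).1 = 0 := (congrArg Prod.fst (packetBits_injective (Prod.ext_iff.1 hq).2)).symm
      rw [h.adj_iff, h3, h0] at hv
      exact absurd hv (by decide)
  · exact absurd hmsg (packetBits_ne_nil _)

/-- The bits of the column of a node of `V₃` that are set reach it in the second round. -/
theorem IsLayered.exists_mem_secondInbox (h : IsLayered I r) (hid : Function.Injective ident)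
    {w v : Fin I.size} (hw : (r w).1 = 2) {c : Fin (I.size / 4)} (hc : c.val = nodeRank ident r w)
    (hv : (r v).1 = 0) (hb : (r v).2.2 c = true) :
    ∃ id, (id, packetBits ((0, (r v).2.1, c, true) : Packet _)) ∈ secondInbox I ident w := by
  obtain ⟨i, hi⟩ : ∃ i, (r v).2.1 = i := ⟨_, rfl⟩
  rw [hi]
  let n := I.size / 4
  -- The relay for row `i` and column `c` is the node of V₂ of rank c - i mod n.
  obtain ⟨u, hu, hru⟩ := h.exists_nodeRank_eq hid 1
    (j := (c.val + (n - i.val)) % n) (Nat.mod_lt _ c.pos)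
  have hshift : c.val = (i.val + nodeRank ident r u) % n := by
    rw [hru, Nat.add_mod_mod, show i.val + (c.val + (n - i.val)) = c.val + n by omega,
      Nat.add_mod_right, Nat.mod_eq_of_lt c.2]
  have hfwd : IsForwarded n (firstInbox I ident u) (ident w) ((0, i, c, true) : Packet n) :=
    (h.isForwarded_iff hu hw).2 ⟨i, c, rfl, hc, hshift, v, hv, hi, hb⟩
  have hex : ∃ p, IsForwarded n (firstInbox I ident u) (ident w) p := ⟨_, hfwd⟩
  -- The column and the rank of the relay determine the row modulo n, so there is no other packet to
  -- choose.
  have hchoose : hex.choose = (0, i, c, true) := by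
    obtain ⟨i', c', he, hc', hs', -⟩ := (h.isForwarded_iff hu hw).1 hex.choose_spec
    obtain rfl : c' = c := Fin.ext (hc'.trans hc.symm)
    have hii : i' = i := by
      have := hs'.symm.trans hshift
      exact Fin.ext (Nat.ModEq.eq_of_lt_of_lt (Nat.ModEq.add_right_cancel' _ this) i'.2 i.2)
    rw [he, hii]
  refine ⟨ident u, mem_secondInbox.2 ⟨u, ?_, ?_⟩⟩
  · rw [h.adj_iff, hw, hu]; decide
  · rw [secondMsg, dif_pos hex, hchoose]

theorem IsLayered.index_received_iff (h : IsLayered I r) {v : Fin I.size} {a : Fin 4}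
    (ha : LayerAdj (r v).1 a) {i : Fin (I.size / 4)} :
    (∃ id c b, (id, packetBits ((a, i, c, b) : Packet _)) ∈ firstInbox I ident v) ↔
      ∃ u, (r u).1 = a ∧ (r u).2.1 = i := by
  simp only [mem_firstInbox h.parse, Prod.mk.injEq]
  constructor
  · rintro ⟨id, c, b, u, -, -, hp⟩
    have hp := packetBits_injective hp
    exact ⟨u, (congrArg Prod.fst hp).symm, (congrArg (fun p => p.2.1) hp).symm⟩
  · rintro ⟨u, rfl, rfl⟩
    exact ⟨_, _, _, u, (h.adj_iff v u).2 ha, rfl, rfl⟩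

/-- In a four-layer graph, all nodes accept if and only if the indices in the outer parts are
exhaustive and no bit is set in the rows of two outer nodes with the same index. -/
theorem IsLayered.locallyValid_iff (h : IsLayered I r) (hid : Function.Injective ident) :
    (∀ v, LocallyValid (I.size / 4) (I.label v) (firstInbox I ident v) (secondInbox I ident v)) ↔
      (∀ i, ∃ v, (r v).1 = 0 ∧ (r v).2.1 = i) ∧ (∀ i, ∃ v, (r v).1 = 3 ∧ (r v).2.1 = i) ∧
      ∀ v v' j, (r v).1 = 0 → (r v').1 = 3 → (r v).2.1 = (r v').2.1 →
        (r v).2.2 j = true → (r v').2.2 j = false := by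
  constructor
  · intro hv
    choose r' hr' hv' using hv
    obtain rfl : r' = r := funext fun v => Option.some.inj ((hr' v).symm.trans (h.parse v))
    replace hv' := fun v => (hv' v).2
    refine ⟨fun i => ?_, fun i => ?_, fun v v' j h0 h3 hi hb => ?_⟩
    · obtain ⟨u, hu, -⟩ := h.exists_nodeRank_eq hid 1 i.2
      exact (h.index_received_iff (by rw [hu]; decide)).1 ((hv' u).1 hu i)
    · obtain ⟨u, hu, -⟩ := h.exists_nodeRank_eq hid 2 i.2
      exact (h.index_received_iff (by rw [hu]; decide)).1 ((hv' u).2.1 hu i)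
    · obtain ⟨w, hw, hj⟩ := h.exists_nodeRank_eq hid 2 j.2
      by_contra hb'
      rw [Bool.not_eq_false] at hb'
      obtain ⟨id, hm⟩ := (h.mem_firstInbox_three hid hw).2 ⟨hj.symm, v', h3, hi.symm, hb'⟩
      obtain ⟨id', hm'⟩ := h.exists_mem_secondInbox hid hw hj.symm h0 hb
      exact (hv' w).2.2 hw _ _ _ _ _ hm hm'
  · rintro ⟨h0, h3, hd⟩ v
    refine ⟨r v, h.parse v, fun b => ?_, fun hv i => ?_, fun hv i => ?_, ?_⟩
    · split_ifs with hb
      · rw [h.senders_eq hb, h.card_partIds hid]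
      · classical
        rw [senders_firstInbox h.parse, Finset.card_eq_zero, Finset.image_eq_empty,
          Finset.filter_eq_empty_iff]
        rintro u - ⟨hu, rfl⟩
        exact hb ((h.adj_iff v u).1 hu)
    · exact (h.index_received_iff (by rw [hv]; decide)).2 (h0 i)
    · exact (h.index_received_iff (by rw [hv]; decide)).2 (h3 i)
    · intro hv i c c' id id' hm hm'
      obtain ⟨hc, v', hv', hi', hb'⟩ := (h.mem_firstInbox_three hid hv).1 ⟨id, hm⟩
      obtain ⟨hc', u, hu, hi, hb⟩ := h.of_mem_secondInbox hv hm'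
      obtain rfl : c = c' := Fin.ext (hc.trans hc'.symm)
      rw [hd u v' c hu hv' (hi.trans hi'.symm) hb] at hb'
      exact absurd hb' (by decide)

/-- If all nodes accept, then the degree conditions force the graph to be a four-layer graph. -/
theorem isLayered_of_locallyValid (hid : Function.Injective ident)
    (hv : ∀ v, LocallyValid (I.size / 4) (I.label v) (firstInbox I ident v)
      (secondInbox I ident v)) :
    ∃ r, IsLayered I r := by
  classical
  choose r hr hrest using hv
  have hdeg : ∀ v b, (Finset.univ.filter fun u => I.graph.Adj v u ∧ (r u).1 = b).card =
      if LayerAdj (r v).1 b then I.size / 4 else 0 := by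
    intro v b
    rw [← (hrest v).1 b, senders_firstInbox hr, Finset.card_image_of_injective _ hid]
  have hpos : 0 < I.size / 4 := (r ⟨0, I.size_pos⟩).2.1.pos
  -- Double counting of the edges between consecutive parts: all degrees across are `I.size / 4`, so
  -- the parts have equal size.
  set P : Fin 4 → Finset (Fin I.size) := fun a => Finset.univ.filter fun v => (r v).1 = a with hP
  have hcount : ∀ a b, LayerAdj a b → (P a).card = (P b).card := by
    intro a b hab
    have hba : LayerAdj b a := hab.symm
    have h := Finset.card_mul_eq_card_mul (s := P a) (t := P b) (m := I.size / 4)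
      (n := I.size / 4) I.graph.Adj ?_ ?_
    · exact Nat.eq_of_mul_eq_mul_right hpos h
    · intro v hv
      have hva : (r v).1 = a := by simpa [hP] using hv
      have := hdeg v b
      rw [hva, if_pos hab] at this
      rw [← this, Finset.bipartiteAbove, hP, Finset.filter_filter]
      simp only [and_comm]
    · intro v hv
      have hvb : (r v).1 = b := by simpa [hP] using hv
      have := hdeg v a
      rw [hvb, if_pos hba] at this
      rw [← this, Finset.bipartiteBelow, hP, Finset.filter_filter]
      simp only [and_comm, I.graph.adj_comm]
  have h01 := hcount 0 1 (by decide)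
  have h12 := hcount 1 2 (by decide)
  have h23 := hcount 2 3 (by decide)
  have hsum : I.size = ∑ a, (P a).card := by
    have := Finset.card_eq_sum_card_fiberwise (s := (Finset.univ : Finset (Fin I.size)))
      (t := (Finset.univ : Finset (Fin 4))) (f := fun v => (r v).1) (fun _ _ => by simp)
    simpa using this
  -- Four equal parts exhaust the nodes, so the size is a multiple of 4 and the division is exact.
  have hcard : ∀ a, (P a).card = I.size / 4 := by
    rw [Fin.sum_univ_four] at hsum
    intro a
    have : (P a).card = (P 0).card := by
      fin_cases a
      · rfl
      · exact h01.symm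
      · exact (h01.trans h12).symm
      · exact (h01.trans (h12.trans h23)).symm
    omega
  refine ⟨r, hr, hcard, fun v u => ⟨fun hadj => ?_, fun hl => ?_⟩⟩
  · by_contra hn
    have := hdeg v (r u).1
    rw [if_neg hn, Finset.card_eq_zero, Finset.filter_eq_empty_iff] at this
    exact this (Finset.mem_univ u) ⟨hadj, rfl⟩
  -- As many neighbors in the part as it has nodes: the two parts are completely joined.
  · have hsub : (Finset.univ.filter fun w => I.graph.Adj v w ∧ (r w).1 = (r u).1) ⊆ P (r u).1 := by
      intro w hw
      simp only [hP, Finset.mem_filter, Finset.mem_univ, true_and] at hw ⊢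
      exact hw.2
    have heq := Finset.eq_of_subset_of_card_le hsub (by rw [hcard, hdeg, if_pos hl])
    have hu : u ∈ P (r u).1 := by simp [hP]
    rw [← heq] at hu
    exact (Finset.mem_filter.1 hu).2.1

end Inboxes

/-! ### Completeness and soundness of the two-round algorithm. -/

/-- On yes-instances, all nodes accept. -/
theorem locallyValid_of_mem_disjFourLayer {I : LabeledGraph} {ident : Fin I.size → ℕ}
    (hid : Function.Injective ident) (hI : I ∈ disjFourLayer) (v : Fin I.size) :
    LocallyValid (I.size / 4) (I.label v) (firstInbox I ident v) (secondInbox I ident v) := by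
  obtain ⟨n, X, Y, e, hd, hl⟩ := hI
  have hsize := Fintype.card_congr e.toEquiv
  simp only [Fintype.card_prod, Fintype.card_fin] at hsize
  obtain rfl : n = I.size / 4 := by omega
  have hparse : ∀ v, ∃ r, parseLabel (I.size / 4) (I.label v) = some r := fun v => by
    rw [hl]; exact exists_parseLabel X Y (e v)
  choose r hr using hparse
  -- Parsing agrees with `e` on the part of every node, but on index and row only for outer nodes.
  have hlabel : ∀ v, (e v).1 = (r v).1 ∧
      ((e v).1 = 0 → (e v).2 = (r v).2.1 ∧ X (e v).2 = (r v).2.2) ∧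
      ((e v).1 = 3 → (e v).2 = (r v).2.1 ∧ Y (e v).2 = (r v).2.2) := fun v =>
    disjLabel_inj ((hl v).symm.trans (eq_disjLabel_of_parseLabel (hr v)))
  have hlay : IsLayered I r := by
    refine ⟨hr, fun a => ?_, fun u v => ?_⟩
    · have himg : (Finset.univ.filter fun v => (r v).1 = a) =
          (Finset.univ.image fun i : Fin (I.size / 4) => e.symm (a, i)) := by
        ext v
        simp only [Finset.mem_filter, Finset.mem_univ, true_and, Finset.mem_image, ← (hlabel v).1]
        constructor
        · rintro rfl
          exact ⟨(e v).2, by simp⟩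
        · rintro ⟨i, rfl⟩
          simp
      rw [himg, Finset.card_image_of_injective _ fun i j hij => ?_, Finset.card_univ,
        Fintype.card_fin]
      exact congrArg Prod.snd (e.symm.injective hij)
    · rw [← e.map_adj_iff, ← (hlabel u).1, ← (hlabel v).1]
      rfl
  refine (hlay.locallyValid_iff hid).2 ⟨fun i => ?_, fun i => ?_, fun u w j hu hw hi hb => ?_⟩ v
  · obtain ⟨h1, h2, -⟩ := hlabel (e.symm (0, i))
    simp only [RelIso.apply_symm_apply, forall_const] at h1 h2
    exact ⟨_, h1.symm, h2.1.symm⟩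
  · obtain ⟨h1, -, h2⟩ := hlabel (e.symm (3, i))
    simp only [RelIso.apply_symm_apply, forall_const] at h1 h2
    exact ⟨_, h1.symm, h2.1.symm⟩
  · obtain ⟨hu1, hu2, -⟩ := hlabel u
    obtain ⟨hw1, -, hw2⟩ := hlabel w
    obtain ⟨hiu, hXu⟩ := hu2 (hu1.trans hu)
    obtain ⟨hiw, hYw⟩ := hw2 (hw1.trans hw)
    by_contra hb'
    rw [Bool.not_eq_false] at hb'
    refine hd ⟨(e u).2, j, by rw [hXu, hb], ?_⟩
    rw [hiu, hi, ← hiw, hYw, hb']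

/-- If all nodes accept, then the labeled graph is a yes-instance. -/
theorem mem_disjFourLayer_of_locallyValid {I : LabeledGraph} {ident : Fin I.size → ℕ}
    (hid : Function.Injective ident)
    (hv : ∀ v, LocallyValid (I.size / 4) (I.label v) (firstInbox I ident v)
      (secondInbox I ident v)) : I ∈ disjFourLayer := by
  classical
  obtain ⟨r, h⟩ := isLayered_of_locallyValid hid hv
  obtain ⟨h0, h3, hd⟩ := (h.locallyValid_iff hid).1 hv
  -- All `I.size / 4` indices occur among as many nodes, so none is repeated.
  have hinj : ∀ a, (∀ i, ∃ v, (r v).1 = a ∧ (r v).2.1 = i) →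
      ∀ v w, (r v).1 = a → (r w).1 = a → (r v).2.1 = (r w).2.1 → v = w := by
    intro a ha v w hva hwa hvw
    have hsurj : Set.SurjOn (fun v => (r v).2.1)
        (Finset.univ.filter fun v => (r v).1 = a : Finset (Fin I.size))
        (Finset.univ : Finset (Fin (I.size / 4))) := by
      intro i _
      obtain ⟨v, hv, hi⟩ := ha i
      exact ⟨v, by simpa using hv, hi⟩
    refine Finset.injOn_of_surjOn_of_card_le (fun v => (r v).2.1) (fun _ _ => by simp) hsurj
      (by rw [h.card_part]; simp) ?_ ?_ hvw
    · simpa using hva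
    · simpa using hwa
  -- Inner nodes have no index of their own; any numbering of their part works, and the rank
  -- provides one.
  set pos : Fin I.size → Fin (I.size / 4) := fun v =>
    if (r v).1 = 0 ∨ (r v).1 = 3 then (r v).2.1 else ⟨nodeRank ident r v, h.nodeRank_lt hid v⟩
    with hposdef
  have heinj : Function.Injective fun v => ((r v).1, pos v) := by
    intro v w hvw
    obtain ⟨h1, h2⟩ := Prod.ext_iff.1 hvw
    simp only at h1 h2
    simp only [hposdef, h1] at h2
    split_ifs at h2 with hc
    · rcases hc with hc | hc
      · exact hinj 0 h0 v w (h1.trans hc) hc h2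
      · exact hinj 3 h3 v w (h1.trans hc) hc h2
    · exact nodeRank_inj hid h1 (congrArg Fin.val h2)
  have hcard : Fintype.card (Fin I.size) = Fintype.card (Fin 4 × Fin (I.size / 4)) := by
    have := Finset.card_eq_sum_card_fiberwise (s := (Finset.univ : Finset (Fin I.size)))
      (t := (Finset.univ : Finset (Fin 4))) (f := fun v => (r v).1) (fun _ _ => by simp)
    rw [Finset.sum_congr rfl fun a _ => h.card_part a] at this
    simpa using this
  set e : Fin I.size ≃ Fin 4 × Fin (I.size / 4) := Equiv.ofBijective _
    ((Fintype.bijective_iff_injective_and_card _).2 ⟨heinj, hcard⟩)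
  have he1 : ∀ v, e v = ((r v).1, pos v) := fun _ => rfl
  have he2 : ∀ p, (r (e.symm p)).1 = p.1 ∧ pos (e.symm p) = p.2 := by
    intro p
    have := he1 (e.symm p)
    rw [Equiv.apply_symm_apply] at this
    exact ⟨(congrArg Prod.fst this).symm, (congrArg Prod.snd this).symm⟩
  have hidx : ∀ a, a = 0 ∨ a = 3 → ∀ i, (r (e.symm (a, i))).2.1 = i := by
    intro a ha i
    obtain ⟨h1, h2⟩ := he2 (a, i)
    refine Eq.trans ?_ h2
    simp only [hposdef]
    rw [if_pos (by rw [h1]; exact ha)]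
  refine ⟨I.size / 4, fun i => (r (e.symm (0, i))).2.2, fun i => (r (e.symm (3, i))).2.2,
    ⟨e, ?_⟩, ?_, fun v => ?_⟩
  · intro u v
    rw [h.adj_iff u v]
    rfl
  · rintro ⟨i, j, hX, hY⟩
    have := hd _ _ j (he2 (0, i)).1 (he2 (3, i)).1
      ((hidx 0 (Or.inl rfl) i).trans (hidx 3 (Or.inr rfl) i).symm) hX
    exact Bool.false_ne_true (this.symm.trans hY)
  · obtain ⟨p, rfl⟩ := e.symm.surjective v
    rw [eq_disjLabel_of_parseLabel (h.parse (e.symm p))]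
    change _ = disjLabel _ _ (e (e.symm p))
    rw [Equiv.apply_symm_apply, (he2 p).1]
    obtain ⟨a, i⟩ := p
    fin_cases a
    · simp only [disjLabel, inputBits]
      change _ ++ (indexBits (r (e.symm (0, i))).2.1 ++ _) = _
      rw [hidx 0 (Or.inl rfl)]
      rfl
    · rfl
    · rfl
    · simp only [disjLabel, inputBits]
      change _ ++ (indexBits (r (e.symm (3, i))).2.1 ++ _) = _
      rw [hidx 3 (Or.inr rfl)]
      rfl

theorem disjFourLayer_mem_classCC (N : ℕ → ℕ) : disjFourLayer ∈ classCC N := by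
  refine ⟨congestAlgorithm, congestAlgorithm_boundedBandwidth, fun I ident hident => ?_⟩
  rw [congestAlgorithm_allAccept_iff]
  exact ⟨fun hI => locallyValid_of_mem_disjFourLayer hident.1 hI,
    mem_disjFourLayer_of_locallyValid hident.1⟩

end HybridModels

theorem mainTheorem11 (N : ℕ → ℕ) (hN : HybridModels.IsIdRange N) :
    HybridModels.disjFourLayer ∈ HybridModels.classCC N \ HybridModels.classLBStar N ∧
    ∀ ε : ℝ, 0 < ε →
      HybridModels.disjFourLayer ∈
        HybridModels.classCC N \ HybridModels.randClassLBStar N (1 / 2 - ε) :=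
  ⟨⟨HybridModels.disjFourLayer_mem_classCC N, HybridModels.disjFourLayer_notMem_classLBStar hN⟩,
    fun _ hε => ⟨HybridModels.disjFourLayer_mem_classCC N,
      HybridModels.disjFourLayer_notMem_randClassLBStar hN hε⟩⟩
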